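/- Let $\Bbbk$ be a field of characteristic zero. For $f \in \Bbbk(x,y)$ let $K\{f\}$ be the field $\Bbbk(x,y)$ with the unique $\Bbbk$-linear Poisson bracket such that $\{x,y\} = f$. Put $K_q := K\{qxy\}$ for $q \in \Bbbk$, $K_{\mathrm{Weyl}} := K\{1\}$, and $K_{1,n,0} := K\{x^{n+1}y\}$ for integers $n \ge 1$. Write $\cong$ for isomorphism of Poisson $\Bbbk$-algebras. Then: 1. For $q, q' \in \Bbbk$, $K_q \cong K_{q'}$ if and only if $q' = q$ or $q' = -q$. 2. $K_{\mathrm{Weyl}} \cong K_{1,1,0}$. 3. $K_q \not\cong K_{\mathrm{Weyl}}$ for all $q \in \Bbbk$; $K_q \not\cong K_{1,n,0}$ for all $q \in \Bbbk$ and $n \ge 2$; $K_{\mathrm{Weyl}} \not\cong K_{1,n,0}$ for all $n \ge 2$; and $K_{1,m,0} \not\cong K_{1,n,0}$ for all $m, n \ge 2$ with $m \ne n$. 4. If $\Bbbk$ is algebraically closed, $q \in \Bbbk^\times$ and $a, b \in \mathbb{Z}$, then $K\{q x^a y^b\}$ is isomorphic to $K_{q'}$ for some $q' \in \Bbbk^\times$,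 or to $K_{\mathrm{Weyl}}$, or to $K_{1,n,0}$ for some $n \ge 2$. By parts 1 and 3, exactly one of these three alternatives holds, with $n$ unique and $q'$ unique up to sign. -/

import Mathlib

open MvPolynomial

/-! Poisson brackets and Poisson isomorphisms. -/

/-- A Poisson bracket on a commutative `𝕜`-algebra `A`: a `𝕜`-bilinear alternating map
which satisfies the Jacobi identity and is a derivation in its second (hence in each) argument. -/
structure PoissonBracket (𝕜 A : Type*) [CommRing 𝕜] [CommRing A] [Algebra 𝕜 A] where
  /-- the bilinear map `{a, b}` -/
  br : A →ₗ[𝕜] A →ₗ[𝕜] A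
  br_self : ∀ a, br a a = 0
  leibniz : ∀ a b c, br a (b * c) = br a b * c + b * br a c
  jacobi : ∀ a b c, br a (br b c) + br b (br c a) + br c (br a b) = 0

/-- `B ≅ B'`: there is a `𝕜`-algebra isomorphism of the underlying algebras which carries the
bracket `B` to the bracket `B'`. -/
def PoissonIso {𝕜 A A' : Type*} [CommRing 𝕜] [CommRing A] [Algebra 𝕜 A]
    [CommRing A'] [Algebra 𝕜 A'] (B : PoissonBracket 𝕜 A) (B' : PoissonBracket 𝕜 A') : Prop :=
  ∃ φ : A ≃ₐ[𝕜] A', ∀ a b : A, φ (B.br a b) = B'.br (φ a) (φ b)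

noncomputable section

/-! The field `𝕜(x, y)` and its partial derivatives. -/

/-- The field `𝕜(x, y)` of rational functions in two variables. -/
abbrev RatFun2 (𝕜 : Type*) [Field 𝕜] : Type _ := FractionRing (MvPolynomial (Fin 2) 𝕜)

namespace RatFun2

variable (𝕜 : Type*) [Field 𝕜]

/-- The variable `x`. -/
def x : RatFun2 𝕜 := algebraMap (MvPolynomial (Fin 2) 𝕜) (RatFun2 𝕜) (X 0)

/-- The variable `y`. -/
def y : RatFun2 𝕜 := algebraMap (MvPolynomial (Fin 2) 𝕜) (RatFun2 𝕜) (X 1)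

lemma x_ne_zero : x 𝕜 ≠ 0 := by
  simp [x]

lemma y_ne_zero : y 𝕜 ≠ 0 := by
  simp [y]

/-- The ring homomorphism `p ↦ p + (∂p/∂xᵢ) ε` from polynomials to dual numbers
over `𝕜(x, y)`. -/
def dualHom (i : Fin 2) :
    MvPolynomial (Fin 2) 𝕜 →+* TrivSqZeroExt (RatFun2 𝕜) (RatFun2 𝕜) where
  toFun p := TrivSqZeroExt.inl (algebraMap _ (RatFun2 𝕜) p)
    + TrivSqZeroExt.inr (algebraMap _ (RatFun2 𝕜) (pderiv i p))
  map_one' := by ext <;> simp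
  map_mul' p q := by
    ext
    · simp
    · simp only [Derivation.leibniz, map_add, map_mul, smul_eq_mul, TrivSqZeroExt.snd_add,
        TrivSqZeroExt.snd_inl, TrivSqZeroExt.snd_inr, TrivSqZeroExt.snd_mul,
        TrivSqZeroExt.fst_add, TrivSqZeroExt.fst_inl, TrivSqZeroExt.fst_inr,
        MulOpposite.smul_eq_mul_unop, MulOpposite.unop_op]
      ring
  map_zero' := by ext <;> simp
  map_add' p q := by
    ext
    · simp
    · simp only [map_add, TrivSqZeroExt.snd_add, TrivSqZeroExt.snd_inl, TrivSqZeroExt.snd_inr,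
        zero_add]

lemma isUnit_dualHom (i : Fin 2) (s : nonZeroDivisors (MvPolynomial (Fin 2) 𝕜)) :
    IsUnit (dualHom 𝕜 i s) := by
  rw [TrivSqZeroExt.isUnit_iff_isUnit_fst]
  simp [dualHom]

/-- The extension of `dualHom` to `𝕜(x, y)`, that is `f ↦ f + (∂f/∂xᵢ) ε`. -/
def dualLift (i : Fin 2) : RatFun2 𝕜 →+* TrivSqZeroExt (RatFun2 𝕜) (RatFun2 𝕜) :=
  IsLocalization.lift (M := nonZeroDivisors (MvPolynomial (Fin 2) 𝕜)) (isUnit_dualHom 𝕜 i)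

lemma dualLift_algebraMap (i : Fin 2) (p : MvPolynomial (Fin 2) 𝕜) :
    dualLift 𝕜 i (algebraMap _ _ p) = dualHom 𝕜 i p :=
  IsLocalization.lift_eq _ p

lemma fst_dualLift (i : Fin 2) (f : RatFun2 𝕜) : (dualLift 𝕜 i f).fst = f := by
  have h : (TrivSqZeroExt.fstHom (RatFun2 𝕜) (RatFun2 𝕜) (RatFun2 𝕜)).toRingHom.comp
      (dualLift 𝕜 i) = RingHom.id _ := by
    apply IsLocalization.ringHom_ext (nonZeroDivisors (MvPolynomial (Fin 2) 𝕜))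
    ext p <;> simp [dualLift_algebraMap, dualHom]
  exact congrArg (fun g : RatFun2 𝕜 →+* RatFun2 𝕜 => g f) h

/-- The partial derivative `∂/∂xᵢ` on `𝕜(x, y)` (where `x₀ = x`, `x₁ = y`): the unique derivation
which extends the partial derivative of polynomials. -/
def pd (i : Fin 2) : Derivation 𝕜 (RatFun2 𝕜) (RatFun2 𝕜) :=
  Derivation.mk'
    { toFun := fun f => (dualLift 𝕜 i f).snd
      map_add' := fun f g => by simp
      map_smul' := fun c f => by
        have hc : algebraMap 𝕜 (RatFun2 𝕜) c
            = algebraMap (MvPolynomial (Fin 2) 𝕜) (RatFun2 𝕜) (C c) := by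
          rw [IsScalarTower.algebraMap_apply 𝕜 (MvPolynomial (Fin 2) 𝕜) (RatFun2 𝕜)]
          rfl
        rw [Algebra.smul_def, map_mul, TrivSqZeroExt.snd_mul, fst_dualLift, fst_dualLift, hc,
          dualLift_algebraMap, ← hc]
        simp [dualHom, Algebra.smul_def] }
    (fun f g => by
      simp only [LinearMap.coe_mk, AddHom.coe_mk, map_mul, TrivSqZeroExt.snd_mul, fst_dualLift, smul_eq_mul,
        MulOpposite.smul_eq_mul_unop, MulOpposite.unop_op]
      ring)

lemma pd_algebraMap (i : Fin 2) (p : MvPolynomial (Fin 2) 𝕜) :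
    pd 𝕜 i (algebraMap _ (RatFun2 𝕜) p) = algebraMap _ (RatFun2 𝕜) (pderiv i p) := by
  change (dualLift 𝕜 i (algebraMap _ _ p)).snd = _
  simp only [dualLift_algebraMap, dualHom, RingHom.coe_mk, MonoidHom.coe_mk, OneHom.coe_mk,
    TrivSqZeroExt.snd_add, TrivSqZeroExt.snd_inl, TrivSqZeroExt.snd_inr, zero_add]

variable {𝕜}

/-- A derivation of `𝕜(x, y)` which kills `x` and `y` is zero. -/
lemma derivation_eq_zero (D : Derivation 𝕜 (RatFun2 𝕜) (RatFun2 𝕜))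
    (hx : D (x 𝕜) = 0) (hy : D (y 𝕜) = 0) : D = 0 := by
  have hp : ∀ p : MvPolynomial (Fin 2) 𝕜, D (algebraMap _ (RatFun2 𝕜) p) = 0 := by
    intro p
    have h : D.compAlgebraMap (MvPolynomial (Fin 2) 𝕜) = 0 := by
      apply MvPolynomial.derivation_ext
      intro i
      fin_cases i
      · exact hx
      · exact hy
    exact congrArg (fun E : Derivation 𝕜 (MvPolynomial (Fin 2) 𝕜) (RatFun2 𝕜) => E p) h
  ext f
  obtain ⟨p, s, hs, rfl⟩ := IsFractionRing.div_surjective (A := MvPolynomial (Fin 2) 𝕜) f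
  simp [Derivation.leibniz_div, hp]

lemma pd_comm (f : RatFun2 𝕜) : pd 𝕜 0 (pd 𝕜 1 f) = pd 𝕜 1 (pd 𝕜 0 f) := by
  have h : ⁅pd 𝕜 0, pd 𝕜 1⁆ = 0 := by
    apply derivation_eq_zero <;>
      simp [Derivation.commutator_apply, x, y, pd_algebraMap, pderiv_X]
  have h2 := congrArg (fun E : Derivation 𝕜 (RatFun2 𝕜) (RatFun2 𝕜) => E f) h
  simp only [Derivation.commutator_apply] at h2
  exact sub_eq_zero.mp h2

end RatFun2

open RatFun2

variable {𝕜 : Type*} [Field 𝕜]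

/-! The Poisson fields `K{f}`. -/

/-- The Poisson field `K{f}`: the field `𝕜(x, y)` with the bracket
`{a, b} = f (∂a/∂x ∂b/∂y - ∂a/∂y ∂b/∂x)`. -/
def flagBracket (f : RatFun2 𝕜) : PoissonBracket 𝕜 (RatFun2 𝕜) where
  br := LinearMap.mk₂ 𝕜 (fun a b => f * (pd 𝕜 0 a * pd 𝕜 1 b - pd 𝕜 1 a * pd 𝕜 0 b))
    (fun a a' b => by simp only [map_add]; ring)
    (fun c a b => by simp only [Derivation.map_smul]; simp only [Algebra.smul_def]; ring)
    (fun a b b' => by simp only [map_add]; ring)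
    (fun c a b => by simp only [Derivation.map_smul]; simp only [Algebra.smul_def]; ring)
  br_self a := by simp only [LinearMap.mk₂_apply]; ring
  leibniz a b c := by
    simp only [LinearMap.mk₂_apply, Derivation.leibniz, smul_eq_mul]; ring
  jacobi a b c := by
    simp only [LinearMap.mk₂_apply, Derivation.leibniz, smul_eq_mul, map_sub, pd_comm]; ring

/-- `K{f}` has `{x, y} = f`. -/
lemma flagBracket_x_y (f : RatFun2 𝕜) : (flagBracket f).br (x 𝕜) (y 𝕜) = f := by
  simp [flagBracket, x, y, pd_algebraMap, pderiv_X]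

/-- `K{f}` is the only Poisson bracket on `𝕜(x, y)` with `{x, y} = f`. -/
lemma eq_flagBracket (f : RatFun2 𝕜) (B : PoissonBracket 𝕜 (RatFun2 𝕜))
    (hB : B.br (x 𝕜) (y 𝕜) = f) : B = flagBracket f := by
  have skew : ∀ (P : PoissonBracket 𝕜 (RatFun2 𝕜)) (a b), P.br a b = - P.br b a := by
    intro P a b
    have h := P.br_self (a + b)
    simp only [map_add, LinearMap.add_apply, P.br_self] at h
    linear_combination h
  have key : ∀ a, (∀ g, (g = x 𝕜 ∨ g = y 𝕜) → B.br a g = (flagBracket f).br a g) →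
      ∀ b, B.br a b = (flagBracket f).br a b := by
    intro a ha b
    have h : Derivation.mk' (B.br a - (flagBracket f).br a) (fun u v => by
        simp only [LinearMap.sub_apply, PoissonBracket.leibniz, smul_eq_mul]; ring) = 0 := by
      apply derivation_eq_zero
      · simp [ha]
      · simp [ha]
    have h2 := congrArg (fun E : Derivation 𝕜 (RatFun2 𝕜) (RatFun2 𝕜) => E b) h
    simpa [sub_eq_zero] using h2
  have hxy := hB.trans (flagBracket_x_y f).symm
  have hx : ∀ b, B.br (x 𝕜) b = (flagBracket f).br (x 𝕜) b := key _ (by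
    rintro g (rfl | rfl)
    · rw [B.br_self, (flagBracket f).br_self]
    · exact hxy)
  have hy : ∀ b, B.br (y 𝕜) b = (flagBracket f).br (y 𝕜) b := key _ (by
    rintro g (rfl | rfl)
    · rw [skew B, skew (flagBracket f), hxy]
    · rw [B.br_self, (flagBracket f).br_self])
  have hall : B.br = (flagBracket f).br := by
    ext a b
    refine key a ?_ b
    rintro g (rfl | rfl)
    · rw [skew B, skew (flagBracket f), hx]
    · rw [skew B, skew (flagBracket f), hy]
  obtain ⟨b, _, _, _⟩ := B
  simp only at hall
  subst hall
  rfl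

/-- The Poisson field `K{q xᵃ yᵇ}` for integers `a`, `b`. -/
def monomialField (q : 𝕜) (a b : ℤ) : PoissonBracket 𝕜 (RatFun2 𝕜) :=
  flagBracket (algebraMap 𝕜 (RatFun2 𝕜) q * x 𝕜 ^ a * y 𝕜 ^ b)

/-- The `q`-skew Poisson field `K_q = K{q x y}`. -/
def qSkewField (q : 𝕜) : PoissonBracket 𝕜 (RatFun2 𝕜) :=
  flagBracket (algebraMap 𝕜 (RatFun2 𝕜) q * x 𝕜 * y 𝕜)

variable (𝕜) in
/-- The Weyl Poisson field `K{1}`. -/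
def weylField : PoissonBracket 𝕜 (RatFun2 𝕜) := flagBracket 1

variable (𝕜) in
/-- The Poisson field `K_{1,n,0} = K{xⁿ⁺¹ y}`. -/
def powField (n : ℕ) : PoissonBracket 𝕜 (RatFun2 𝕜) := flagBracket (x 𝕜 ^ (n + 1) * y 𝕜)

end

/-! Embed `𝕜(x, y)` in `𝕜((x))((y))` and use the `y`-adic valuation with its residues in `𝕜((x))`.
Both `K_q` and `K_{1,n,0}` have brackets of the form `{x, y} = q xⁿ⁺¹ y`, which do not lower the
`y`-order. If `{u, w} = u w h`, then `h` has order at least zero, and the lowest terms `a`, `b` of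
`u`, `w` satisfy `ord(w) b δ(a) - ord(u) a δ(b) = a b h₀`, where `δ = q xⁿ⁺¹ d/dx` and `h₀` is the
coefficient of `y⁰` in `h` (`residueDerivation_yLead`).

An isomorphism onto such a field is a pair of generators `u`, `w` with prescribed `h`. For `K_p` the
constant `h = p` makes `p` an integer multiple of `q`; two non-zero parameters that are integer
multiples of each other agree up to sign. For the Weyl field and `K_{1,m,0}`, `h` is a monomial in
`u`, `w`. While `h` has positive order, the equation makes the residue of a suitable monomial `W`
constant; subtracting that constant gives a new generator and strictly lowers the order of `h`
(`exists_blowup`). At order zero, the equation determines the residue `s` of some generator of order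
zero, up to an additive constant for the Weyl field and after any blow-up. Generation of `x` forces
such an `s`, if its order is non-zero, to have order `±1` (`order_yLead_dvd_one`). This fixes `n`.

The positive results come from unimodular monomial substitutions, which preserve `{u, w}/(u w)`, and
from absorbing the scalar through a root. -/

open RatFun2

/-! Leading terms and coefficientwise derivations of Hahn series over `ℤ`. -/

section HahnSeriesLemmas

/-- The coefficientwise algebra structure, preferred to the one through power series. -/
noncomputable instance (priority := high) hahnSeriesAlgebra {R A : Type*} [CommSemiring R]
    [Semiring A] [Algebra R A] : Algebra R (HahnSeries ℤ A) := HahnSeries.instAlgebra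

variable {A : Type*} [Field A]

/-- The bounds `i` and `j` need not be the orders: a derivation may kill the lowest term of a
series. -/
lemma coeff_mul_add_of_lt {f g : HahnSeries ℤ A} {i j : ℤ} (hf : ∀ m < i, f.coeff m = 0)
    (hg : ∀ m < j, g.coeff m = 0) :
    (∀ m < i + j, (f * g).coeff m = 0) ∧ (f * g).coeff (i + j) = f.coeff i * g.coeff j := by
  constructor
  · intro m hm
    rw [HahnSeries.coeff_mul]
    refine Finset.sum_eq_zero fun p hp => ?_
    rw [Finset.mem_antidiagonal] at hp
    by_cases h : p.1 < i
    · rw [hf _ h, zero_mul]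
    · rw [hg _ (by omega), mul_zero]
  · rw [HahnSeries.coeff_mul]
    refine (Finset.sum_eq_single (i, j) ?_ ?_)
    · intro p hp hne
      rw [Finset.mem_antidiagonal] at hp
      by_cases h : p.1 < i
      · rw [hf _ h, zero_mul]
      · have h1 : p.1 ≠ i := fun h1 => hne (Prod.ext h1 (by simp only; omega))
        rw [hg _ (by omega), mul_zero]
    · intro hp
      simp only [Finset.mem_antidiagonal, HahnSeries.mem_support, and_true, not_and_or,
        not_not] at hp
      rcases hp with h | h <;> simp [h]

lemma order_zpow (f : HahnSeries ℤ A) (n : ℤ) : (f ^ n).order = n * f.order := by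
  have hinv : ∀ g : HahnSeries ℤ A, (g⁻¹).order = - g.order := by
    intro g
    by_cases hg : g = 0
    · simp [hg]
    · have h := HahnSeries.order_mul hg (inv_ne_zero hg)
      rw [mul_inv_cancel₀ hg, HahnSeries.order_one] at h
      linarith
  obtain ⟨m, rfl | rfl⟩ := n.eq_nat_or_neg
  · simp
  · rw [zpow_neg, hinv]; simp

variable (A) in
/-- The leading coefficient as a multiplicative map. -/
noncomputable def leadingCoeffHom : HahnSeries ℤ A →*₀ A where
  toFun f := f.leadingCoeff
  map_zero' := HahnSeries.leadingCoeff_zero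
  map_one' := HahnSeries.leadingCoeff_one
  map_mul' f g := HahnSeries.leadingCoeff_mul f g

lemma leadingCoeff_zpow (f : HahnSeries ℤ A) (n : ℤ) :
    (f ^ n).leadingCoeff = f.leadingCoeff ^ n :=
  map_zpow₀ (leadingCoeffHom A) f n

lemma order_eq_of_coeff {f : HahnSeries ℤ A} {i : ℤ} (hf : ∀ m < i, f.coeff m = 0)
    (hi : f.coeff i ≠ 0) : f.order = i := by
  apply le_antisymm (HahnSeries.order_le_of_coeff_ne_zero hi)
  by_contra! h
  have := HahnSeries.coeff_order_eq_zero.1 (hf _ h)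
  simp [this] at hi

/-- The action of maps on the coefficients of a Laurent series. -/
def coeffMap {𝕜 : Type*} [Field 𝕜] [Algebra 𝕜 A] (d : ℤ → A →ₗ[𝕜] A) (f : HahnSeries ℤ A) :
    HahnSeries ℤ A :=
  ⟨fun n => d n (f.coeff n), f.isPWO_support.mono fun n hn h0 => hn (by
    change d n (f.coeff n) = 0; rw [h0, map_zero])⟩

lemma support_coeffMap_subset {𝕜 : Type*} [Field 𝕜] [Algebra 𝕜 A] (d : ℤ → A →ₗ[𝕜] A)
    (f : HahnSeries ℤ A) : (coeffMap d f).support ⊆ f.support :=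
  fun n hn h0 => hn (by simp only [coeffMap, h0, map_zero])

/-- The derivation of `A((t))` given by maps on the coefficients. -/
noncomputable def coeffDerivation {𝕜 : Type*} [Field 𝕜] [Algebra 𝕜 A] (d : ℤ → A →ₗ[𝕜] A)
    (h : ∀ m n a b, d (m + n) (a * b) = a * d n b + b * d m a) :
    Derivation 𝕜 (HahnSeries ℤ A) (HahnSeries ℤ A) :=
  Derivation.mk'
    { toFun := coeffMap d
      map_add' := fun f g => by ext n; simp [coeffMap]
      map_smul' := fun c f => by ext n; simp [coeffMap] }
    (fun f g => by
      ext n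
      change d n ((f * g).coeff n) = (f * coeffMap d g).coeff n + (g * coeffMap d f).coeff n
      -- All three convolutions are written over pairs from the supports of `f` and `g`, although
      -- `coeffMap` may shrink a support.
      rw [HahnSeries.coeff_mul_right' g.isPWO_support (support_coeffMap_subset d g), mul_comm g,
        HahnSeries.coeff_mul_left' f.isPWO_support (support_coeffMap_subset d f),
        HahnSeries.coeff_mul, map_sum, ← Finset.sum_add_distrib]
      refine Finset.sum_congr rfl fun p hp => ?_
      rw [Finset.mem_antidiagonal] at hp
      rw [← hp.2.2, h, coeffMap, coeffMap]
      ring)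

lemma coeffDerivation_coeff {𝕜 : Type*} [Field 𝕜] [Algebra 𝕜 A] (d : ℤ → A →ₗ[𝕜] A)
    (h : ∀ m n a b, d (m + n) (a * b) = a * d n b + b * d m a) (f : HahnSeries ℤ A) (n : ℤ) :
    (coeffDerivation d h f).coeff n = d n (f.coeff n) := rfl

/-- The Euler derivation `t d/dt` of `A((t))`. -/
noncomputable def euler (𝕜 A : Type*) [Field 𝕜] [Field A] [Algebra 𝕜 A] :
    Derivation 𝕜 (HahnSeries ℤ A) (HahnSeries ℤ A) :=
  coeffDerivation (fun n => n • LinearMap.id) (fun m n a b => by simp; ring)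

lemma euler_coeff (𝕜 : Type*) [Field 𝕜] [Algebra 𝕜 A] (f : HahnSeries ℤ A) (n : ℤ) :
    (euler 𝕜 A f).coeff n = n * f.coeff n := by
  simp [euler, coeffDerivation_coeff]

/-- The extension of a derivation of `A` to `A((t))` with `t ↦ 0`. -/
noncomputable def mapDerivation {𝕜 : Type*} [Field 𝕜] [Algebra 𝕜 A] (D : Derivation 𝕜 A A) :
    Derivation 𝕜 (HahnSeries ℤ A) (HahnSeries ℤ A) :=
  coeffDerivation (fun _ => D) (fun m n a b => by simp)

lemma mapDerivation_coeff {𝕜 : Type*} [Field 𝕜] [Algebra 𝕜 A] (D : Derivation 𝕜 A A)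
    (f : HahnSeries ℤ A) (n : ℤ) : (mapDerivation D f).coeff n = D (f.coeff n) := rfl

lemma eq_C_of_euler_eq_zero {𝕜 : Type*} [Field 𝕜] [CharZero A] [Algebra 𝕜 A]
    {f : HahnSeries ℤ A} (h : euler 𝕜 A f = 0) : f = HahnSeries.C (f.coeff 0) := by
  ext n
  have h2 := congrArg (fun g => HahnSeries.coeff g n) h
  simp only [euler_coeff, HahnSeries.coeff_zero, mul_eq_zero, Int.cast_eq_zero] at h2
  by_cases hn : n = 0
  · simp [hn]
  · simp [HahnSeries.C_apply, HahnSeries.coeff_single_of_ne hn, h2.resolve_left hn]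

lemma order_leadingCoeff_add {f g : HahnSeries ℤ A} (hf : f ≠ 0) (hf0 : f.order = 0)
    (hg : ∀ m ≤ 0, g.coeff m = 0) :
    f + g ≠ 0 ∧ (f + g).order = 0 ∧ (f + g).leadingCoeff = f.leadingCoeff := by
  have h0 : (f + g).coeff 0 = f.leadingCoeff := by
    rw [HahnSeries.coeff_add, hg 0 le_rfl, add_zero, HahnSeries.leadingCoeff_eq, hf0]
  have hne : (f + g).coeff 0 ≠ 0 := by rwa [h0, HahnSeries.leadingCoeff_ne_zero]
  have hord : (f + g).order = 0 := order_eq_of_coeff (fun m hm => by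
    rw [HahnSeries.coeff_add, hg m hm.le, HahnSeries.coeff_eq_zero_of_lt_order (hf0 ▸ hm),
      add_zero]) hne
  refine ⟨fun h => hne (by rw [h, HahnSeries.coeff_zero]), hord, ?_⟩
  rw [HahnSeries.leadingCoeff_eq, hord, h0]

/-- The leading term of a polynomial expression in a series of positive order, when the
coefficients have order zero. -/
lemma exists_order_eval₂ {R : Type*} [CommRing R] (e : R →+* HahnSeries ℤ A)
    (he : ∀ c, c ≠ 0 → e c ≠ 0 ∧ (e c).order = 0) {u : HahnSeries ℤ A} (hu : 0 < u.order)
    (P : Polynomial R) (hP : P ≠ 0) :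
    P.eval₂ e u ≠ 0 ∧ ∃ (i : ℕ) (c : R), c ≠ 0 ∧ (P.eval₂ e u).order = i * u.order ∧
      (P.eval₂ e u).leadingCoeff = (e c).leadingCoeff * u.leadingCoeff ^ i ∧
      (P.coeff 0 = 0 → 1 ≤ i) := by
  have hu0 : u ≠ 0 := by rintro rfl; simp at hu
  induction P using Polynomial.recOnHorner with
  | M0 => exact absurd rfl hP
  -- The vanishing constant term of `p` gives its value positive order, so `a` alone supplies the
  -- lowest term; the clause `1 ≤ i` is carried for this.
  | MC p a hp ha ih =>
    have hg : ∀ m ≤ 0, (p.eval₂ e u).coeff m = 0 := by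
      intro m hm
      by_cases h : p = 0
      · simp [h]
      · obtain ⟨-, i, c, -, h1, -, h2⟩ := ih h
        apply HahnSeries.coeff_eq_zero_of_lt_order
        have := h2 hp
        rw [h1]
        have : (0 : ℤ) < i * u.order := mul_pos (by exact_mod_cast this) hu
        omega
    obtain ⟨h1, h2, h3⟩ := order_leadingCoeff_add (he a ha).1 (he a ha).2 hg
    rw [add_comm, Polynomial.eval₂_add, Polynomial.eval₂_C]
    exact ⟨h1, 0, a, ha, by simp [h2], by simp [h3], by simp [hp, ha]⟩
  | MX p hp ih =>
    obtain ⟨h0, i, c, hc, h1, h2, -⟩ := ih hp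
    rw [Polynomial.eval₂_mul, Polynomial.eval₂_X]
    refine ⟨mul_ne_zero h0 hu0, i + 1, c, hc, ?_, ?_, by simp⟩
    · rw [HahnSeries.order_mul h0 hu0, h1]; push_cast; ring
    · rw [HahnSeries.leadingCoeff_mul, h2, pow_succ, mul_assoc]

/-- A polynomial in a series of order zero is regular, with the expected constant term. -/
lemma coeff_zero_eval₂ {R : Type*} [CommRing R] (e : R →+* A) {r : HahnSeries ℤ A}
    (hr : ∀ m < 0, r.coeff m = 0) (P : Polynomial R) :
    (∀ m < 0, (P.eval₂ (HahnSeries.C.comp e) r).coeff m = 0) ∧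
      (P.eval₂ (HahnSeries.C.comp e) r).coeff 0 = P.eval₂ e (r.coeff 0) := by
  have hC : ∀ (a : A), ∀ m < 0, (HahnSeries.C a : HahnSeries ℤ A).coeff m = 0 := fun a m hm =>
    HahnSeries.coeff_single_of_ne hm.ne
  induction P using Polynomial.recOnHorner with
  | M0 => simp
  | MC p a hp ha ih =>
    simp only [Polynomial.eval₂_add, Polynomial.eval₂_C, HahnSeries.coeff_add, ih.2]
    refine ⟨fun m hm => ?_, by simp⟩
    rw [ih.1 m hm, zero_add]
    exact hC _ m hm
  | MX p hp ih =>
    have h := coeff_mul_add_of_lt ih.1 hr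
    rw [add_zero, ih.2] at h
    simpa only [Polynomial.eval₂_mul, Polynomial.eval₂_X] using h

end HahnSeriesLemmas

/-! Algebraic independence by a Jacobian criterion. -/

/-- By the chain rule, the partial derivatives of a relation, evaluated at `u`, solve a homogeneous
linear system with non-zero determinant. They are therefore relations of smaller degree, and
induction leaves only constants. -/
lemma aeval_injective_of_jacobian {𝕜 L : Type*} [Field 𝕜] [CharZero 𝕜] [Field L] [Algebra 𝕜 L]
    (D E : Derivation 𝕜 L L) (u : Fin 2 → L)
    (h : D (u 0) * E (u 1) - E (u 0) * D (u 1) ≠ 0) :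
    Function.Injective (aeval u : MvPolynomial (Fin 2) 𝕜 →ₐ[𝕜] L) := by
  have chain : ∀ (D : Derivation 𝕜 L L) (p : MvPolynomial (Fin 2) 𝕜),
      D (aeval u p) = aeval u (pderiv 0 p) * D (u 0) + aeval u (pderiv 1 p) * D (u 1) := by
    intro D p
    induction p using MvPolynomial.induction_on with
    | C a => simp
    | add p q hp hq => simp only [map_add, hp, hq]; ring
    | mul_X p i hp =>
      simp only [map_mul, Derivation.leibniz, smul_eq_mul, hp, map_add, pderiv_X, aeval_X]
      fin_cases i <;> simp <;> ring
  rw [injective_iff_map_eq_zero]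
  have main : ∀ (n : ℕ) (p : MvPolynomial (Fin 2) 𝕜), p.totalDegree ≤ n → aeval u p = 0 →
      p = 0 := by
    intro n
    induction n with
    | zero =>
      intro p hp h0
      rw [totalDegree_eq_zero_iff_eq_C.1 (Nat.le_zero.1 hp)] at h0 ⊢
      simpa using h0
    | succ n ih =>
      intro p hp h0
      have hdeg : ∀ i, (pderiv i p).totalDegree ≤ n := by
        intro i
        refine Finset.sup_le fun m hm => ?_
        rw [mem_support_iff, coeff_pderiv] at hm
        have h1 := le_totalDegree (mem_support_iff.2 (left_ne_zero_of_mul hm))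
        rw [Finsupp.sum_add_index' (by simp) (by simp), Finsupp.sum_single_index rfl] at h1
        omega
      have hd : ∀ i, pderiv i p = 0 := by
        have h1 := chain D p
        have h2 := chain E p
        rw [h0, map_zero] at h1 h2
        -- Cramer's rule.
        have h3 : aeval u (pderiv 0 p) = 0 := by
          apply (mul_eq_zero.1 (_ : aeval u (pderiv 0 p) * _ = 0)).resolve_right h
          linear_combination E (u 1) * (-h1) + D (u 1) * h2
        have h4 : aeval u (pderiv 1 p) = 0 := by
          apply (mul_eq_zero.1 (_ : aeval u (pderiv 1 p) * _ = 0)).resolve_right h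
          linear_combination E (u 0) * h1 - D (u 0) * h2
        intro i
        fin_cases i
        · exact ih _ (hdeg _) h3
        · exact ih _ (hdeg _) h4
      have hC : p = C (coeff 0 p) := by
        ext m
        rw [coeff_C]
        split_ifs with hm
        · rw [hm]
        · obtain ⟨i, hi⟩ := Finsupp.ne_iff.1 (Ne.symm hm)
          have hmi : m - Finsupp.single i 1 + Finsupp.single i 1 = m :=
            tsub_add_cancel_of_le (Finsupp.single_le_iff.2 (Nat.one_le_iff_ne_zero.2 hi))
          have h1 := coeff_pderiv (i := i) p (m - Finsupp.single i 1)
          rw [hd, hmi, coeff_zero] at h1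
          exact (mul_eq_zero.1 h1.symm).resolve_right (Nat.cast_add_one_ne_zero _)
      rw [hC] at h0 ⊢
      simpa using h0
  exact fun p hp => main _ p le_rfl hp
/-! The embedding of `𝕜(x, y)` into `𝕜((x))((y))`. -/

section Embedding

/-- `u` and `w` generate `𝕜(x, y)` as a field over `𝕜`. -/
def Generates {𝕜 : Type*} [Field 𝕜] (u w : RatFun2 𝕜) : Prop :=
  ∀ E : IntermediateField 𝕜 (RatFun2 𝕜), u ∈ E → w ∈ E → E = ⊤

variable (𝕜 : Type*) [Field 𝕜]

lemma generates_x_y : Generates (x 𝕜) (y 𝕜) := by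
  intro E hx hy
  have hp : ∀ p : MvPolynomial (Fin 2) 𝕜, algebraMap _ (RatFun2 𝕜) p ∈ E := by
    intro p
    induction p using MvPolynomial.induction_on with
    | C a =>
      have h := E.algebraMap_mem a
      rwa [IsScalarTower.algebraMap_apply 𝕜 (MvPolynomial (Fin 2) 𝕜)] at h
    | add p q hp hq => rw [map_add]; exact E.add_mem hp hq
    | mul_X p i hp =>
      rw [map_mul]
      refine E.mul_mem hp ?_
      fin_cases i
      · exact hx
      · exact hy
  rw [eq_top_iff]
  rintro f -
  obtain ⟨p, s, -, rfl⟩ := IsFractionRing.div_surjective (A := MvPolynomial (Fin 2) 𝕜) f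
  exact E.div_mem (hp p) (hp s)

lemma pd_x (i : Fin 2) : pd 𝕜 i (x 𝕜) = if i = 0 then 1 else 0 := by
  rw [x, pd_algebraMap, pderiv_X, Pi.single_apply]
  fin_cases i <;> simp

lemma pd_y (i : Fin 2) : pd 𝕜 i (y 𝕜) = if i = 1 then 1 else 0 := by
  rw [y, pd_algebraMap, pderiv_X, Pi.single_apply]
  fin_cases i <;> simp

/-- The field `𝕜((x))((y))`. -/
abbrev Laurent2 : Type _ := HahnSeries ℤ (HahnSeries ℤ 𝕜)

/-- The variables of `𝕜((x))((y))`. -/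
noncomputable def laurentVar : Fin 2 → Laurent2 𝕜 :=
  ![HahnSeries.C (HahnSeries.single 1 1), HahnSeries.single 1 1]

/-- The derivation `x ∂/∂x` of `𝕜((x))((y))`. -/
noncomputable def eulerX : Derivation 𝕜 (Laurent2 𝕜) (Laurent2 𝕜) := mapDerivation (euler 𝕜 𝕜)

/-- The derivation `y ∂/∂y` of `𝕜((x))((y))`. -/
noncomputable def eulerY : Derivation 𝕜 (Laurent2 𝕜) (Laurent2 𝕜) := euler 𝕜 (HahnSeries ℤ 𝕜)

lemma euler_single {A : Type*} [Field A] [Algebra 𝕜 A] (n : ℤ) (a : A) :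
    euler 𝕜 A (HahnSeries.single n a) = HahnSeries.single n (n * a) := by
  ext m
  rw [euler_coeff]
  by_cases h : m = n
  · simp [h]
  · simp [HahnSeries.coeff_single_of_ne h]

lemma eulerX_laurentVar_zero : eulerX 𝕜 (laurentVar 𝕜 0) = laurentVar 𝕜 0 := by
  ext1; funext m
  rw [eulerX, mapDerivation_coeff]
  by_cases h : m = 0
  · simp [laurentVar, h, HahnSeries.C_apply, euler_single]
  · simp [laurentVar, HahnSeries.C_apply, HahnSeries.coeff_single_of_ne h]

lemma eulerX_laurentVar_one : eulerX 𝕜 (laurentVar 𝕜 1) = 0 := by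
  ext1; funext m
  rw [eulerX, mapDerivation_coeff]
  by_cases h : m = 1
  · simp [laurentVar, h, Derivation.map_one_eq_zero]
  · simp [laurentVar, HahnSeries.coeff_single_of_ne h]

lemma eulerY_laurentVar_zero : eulerY 𝕜 (laurentVar 𝕜 0) = 0 := by
  simp [eulerY, laurentVar, HahnSeries.C_apply, euler_single]

lemma eulerY_laurentVar_one : eulerY 𝕜 (laurentVar 𝕜 1) = laurentVar 𝕜 1 := by
  simp [eulerY, laurentVar, euler_single]

variable [CharZero 𝕜]

lemma aeval_laurentVar_injective :
    Function.Injective (aeval (laurentVar 𝕜) : MvPolynomial (Fin 2) 𝕜 →ₐ[𝕜] Laurent2 𝕜) := by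
  apply aeval_injective_of_jacobian (eulerX 𝕜) (eulerY 𝕜)
  simp only [eulerX_laurentVar_zero, eulerX_laurentVar_one, eulerY_laurentVar_one,
    eulerY_laurentVar_zero]
  simp [laurentVar]

/-- The embedding of `𝕜(x, y)` into `𝕜((x))((y))`. -/
noncomputable def laurentEmb : RatFun2 𝕜 →ₐ[𝕜] Laurent2 𝕜 :=
  IsFractionRing.liftAlgHom (aeval_laurentVar_injective 𝕜)

lemma laurentEmb_x : laurentEmb 𝕜 (x 𝕜) = laurentVar 𝕜 0 := by
  simp [laurentEmb, x, IsFractionRing.liftAlgHom_apply]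

lemma laurentEmb_y : laurentEmb 𝕜 (y 𝕜) = laurentVar 𝕜 1 := by
  simp [laurentEmb, y, IsFractionRing.liftAlgHom_apply]

variable {𝕜}

/-- The elements on which the two sides agree form an intermediate field, so the generators `x` and
`y` suffice. -/
lemma laurentEmb_derivation (D : Derivation 𝕜 (RatFun2 𝕜) (RatFun2 𝕜))
    (E : Derivation 𝕜 (Laurent2 𝕜) (Laurent2 𝕜))
    (hx : laurentEmb 𝕜 (D (x 𝕜)) = E (laurentEmb 𝕜 (x 𝕜)))
    (hy : laurentEmb 𝕜 (D (y 𝕜)) = E (laurentEmb 𝕜 (y 𝕜))) (f : RatFun2 𝕜) :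
    laurentEmb 𝕜 (D f) = E (laurentEmb 𝕜 f) := by
  let S : IntermediateField 𝕜 (RatFun2 𝕜) :=
    { carrier := {f | laurentEmb 𝕜 (D f) = E (laurentEmb 𝕜 f)}
      mul_mem' := fun {a b} ha hb => by
        simp only [Set.mem_ofPred_eq] at ha hb ⊢
        simp only [Derivation.leibniz, map_add, smul_eq_mul, map_mul, ha, hb]
      add_mem' := fun {a b} ha hb => by
        simp only [Set.mem_ofPred_eq] at ha hb ⊢
        simp only [map_add, ha, hb]
      algebraMap_mem' := fun c => by simp
      inv_mem' := fun a ha => by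
        simp only [Set.mem_ofPred_eq] at ha ⊢
        simp only [Derivation.leibniz_inv, smul_eq_mul, map_mul, map_neg, map_pow, map_inv₀, ha] }
  have h : f ∈ S := by
    rw [generates_x_y 𝕜 S hx hy]
    trivial
  exact h

lemma laurentEmb_pd_zero (f : RatFun2 𝕜) :
    laurentEmb 𝕜 (x 𝕜 * pd 𝕜 0 f) = eulerX 𝕜 (laurentEmb 𝕜 f) := by
  refine laurentEmb_derivation (x 𝕜 • pd 𝕜 0) (eulerX 𝕜) ?_ ?_ f
  · rw [laurentEmb_x, eulerX_laurentVar_zero, ← laurentEmb_x]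
    simp [pd_x]
  · rw [laurentEmb_y, eulerX_laurentVar_one]
    simp [pd_y]

lemma laurentEmb_pd_one (f : RatFun2 𝕜) :
    laurentEmb 𝕜 (y 𝕜 * pd 𝕜 1 f) = eulerY 𝕜 (laurentEmb 𝕜 f) := by
  refine laurentEmb_derivation (y 𝕜 • pd 𝕜 1) (eulerY 𝕜) ?_ ?_ f
  · rw [laurentEmb_x, eulerY_laurentVar_zero]
    simp [pd_x]
  · rw [laurentEmb_y, eulerY_laurentVar_one, ← laurentEmb_y]
    simp [pd_y]

/-- The order in `y`. -/
noncomputable def yOrder (f : RatFun2 𝕜) : ℤ := (laurentEmb 𝕜 f).order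

/-- The coefficient in `𝕜((x))` of the lowest power of `y`. -/
noncomputable def yLead (f : RatFun2 𝕜) : HahnSeries ℤ 𝕜 := (laurentEmb 𝕜 f).leadingCoeff

lemma laurentEmb_ne_zero {f : RatFun2 𝕜} (hf : f ≠ 0) : laurentEmb 𝕜 f ≠ 0 := by
  simpa using hf

lemma yLead_ne_zero {f : RatFun2 𝕜} (hf : f ≠ 0) : yLead f ≠ 0 :=
  HahnSeries.leadingCoeff_ne_zero.2 (laurentEmb_ne_zero hf)

lemma yOrder_mul {f g : RatFun2 𝕜} (hf : f ≠ 0) (hg : g ≠ 0) :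
    yOrder (f * g) = yOrder f + yOrder g := by
  rw [yOrder, map_mul, HahnSeries.order_mul (laurentEmb_ne_zero hf) (laurentEmb_ne_zero hg)]
  rfl

lemma yOrder_zpow (f : RatFun2 𝕜) (n : ℤ) : yOrder (f ^ n) = n * yOrder f := by
  rw [yOrder, map_zpow₀, order_zpow, yOrder]

lemma yLead_mul (f g : RatFun2 𝕜) : yLead (f * g) = yLead f * yLead g := by
  rw [yLead, map_mul, HahnSeries.leadingCoeff_mul]
  rfl

lemma yLead_zpow (f : RatFun2 𝕜) (n : ℤ) : yLead (f ^ n) = yLead f ^ n := by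
  rw [yLead, map_zpow₀, leadingCoeff_zpow, yLead]

lemma laurentEmb_coeff_yOrder (f : RatFun2 𝕜) : (laurentEmb 𝕜 f).coeff (yOrder f) = yLead f :=
  HahnSeries.leadingCoeff_eq.symm

/-- The bracket `{x, y} = q xⁿ⁺¹ y`, common to the fields `K_q` and `K_{1,n,0}`. -/
noncomputable def scaledPowField (q : 𝕜) (n : ℕ) : PoissonBracket 𝕜 (RatFun2 𝕜) :=
  flagBracket (algebraMap 𝕜 (RatFun2 𝕜) q * x 𝕜 ^ (n + 1) * y 𝕜)

variable (𝕜) in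
/-- The derivation `q xⁿ⁺¹ d/dx` of `𝕜((x))`. -/
noncomputable def residueDerivation (q : 𝕜) (n : ℕ) :
    Derivation 𝕜 (HahnSeries ℤ 𝕜) (HahnSeries ℤ 𝕜) :=
  HahnSeries.single (n : ℤ) q • euler 𝕜 𝕜

/-- In terms of Euler derivations the prefactor is `q xⁿ`, free of `y`; hence the bracket respects
the `y`-adic filtration. -/
lemma laurentEmb_bracket (q : 𝕜) (n : ℕ) (f g : RatFun2 𝕜) :
    laurentEmb 𝕜 ((scaledPowField q n).br f g) = HahnSeries.C (HahnSeries.single (n : ℤ) q) *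
      (eulerX 𝕜 (laurentEmb 𝕜 f) * eulerY 𝕜 (laurentEmb 𝕜 g) -
        eulerY 𝕜 (laurentEmb 𝕜 f) * eulerX 𝕜 (laurentEmb 𝕜 g)) := by
  have h : (scaledPowField q n).br f g = algebraMap 𝕜 (RatFun2 𝕜) q * x 𝕜 ^ n *
      ((x 𝕜 * pd 𝕜 0 f) * (y 𝕜 * pd 𝕜 1 g) - (y 𝕜 * pd 𝕜 1 f) * (x 𝕜 * pd 𝕜 0 g)) := by
    simp only [scaledPowField, flagBracket, LinearMap.mk₂_apply]
    ring
  rw [h, map_mul, map_sub, map_mul _ (x 𝕜 * _), map_mul _ (y 𝕜 * _), laurentEmb_pd_zero,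
    laurentEmb_pd_zero, laurentEmb_pd_one, laurentEmb_pd_one, map_mul, map_pow, laurentEmb_x,
    AlgHom.commutes, laurentVar, Matrix.cons_val_zero, ← map_pow, HahnSeries.single_pow,
    HahnSeries.algebraMap_apply, ← map_mul, HahnSeries.algebraMap_apply, Algebra.algebraMap_self,
    RingHom.id_apply, HahnSeries.C_apply q, HahnSeries.single_mul_single]
  simp

/-- Leading terms in the bracket. -/
lemma residueDerivation_yLead {q : 𝕜} {n : ℕ} {f g h : RatFun2 𝕜} (hf : f ≠ 0) (hg : g ≠ 0)
    (hh : h ≠ 0) (hb : (scaledPowField q n).br f g = f * g * h) :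
    0 ≤ yOrder h ∧
      residueDerivation 𝕜 q n (yLead f) * (yOrder g * yLead g) -
        (yOrder f * yLead f) * residueDerivation 𝕜 q n (yLead g) =
        yLead f * yLead g * (laurentEmb 𝕜 h).coeff 0 := by
  have hlow : ∀ (f : RatFun2 𝕜), ∀ m < yOrder f, (laurentEmb 𝕜 f).coeff m = 0 :=
    fun f m hm => HahnSeries.coeff_eq_zero_of_lt_order hm
  have hX : ∀ (f : RatFun2 𝕜), ∀ m < yOrder f, (eulerX 𝕜 (laurentEmb 𝕜 f)).coeff m = 0 :=
    fun f m hm => by rw [eulerX, mapDerivation_coeff, hlow f m hm, map_zero]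
  have hY : ∀ (f : RatFun2 𝕜), ∀ m < yOrder f, (eulerY 𝕜 (laurentEmb 𝕜 f)).coeff m = 0 :=
    fun f m hm => by rw [eulerY, euler_coeff, hlow f m hm, mul_zero]
  have h1 := coeff_mul_add_of_lt (hX f) (hY g)
  have h2 := coeff_mul_add_of_lt (hY f) (hX g)
  have hB := laurentEmb_bracket q n f g
  rw [hb] at hB
  have hcoeff : ∀ m, (laurentEmb 𝕜 (f * g * h)).coeff m = HahnSeries.single (n : ℤ) q *
      ((eulerX 𝕜 (laurentEmb 𝕜 f) * eulerY 𝕜 (laurentEmb 𝕜 g)).coeff m -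
        (eulerY 𝕜 (laurentEmb 𝕜 f) * eulerX 𝕜 (laurentEmb 𝕜 g)).coeff m) := by
    intro m
    rw [hB, HahnSeries.C_apply, HahnSeries.coeff_single_zero_mul, HahnSeries.coeff_sub]
  have hfg : f * g ≠ 0 := mul_ne_zero hf hg
  -- Otherwise `f * g * h` would have a term below `ord f + ord g`, where the bracket has none.
  have hpos : 0 ≤ yOrder h := by
    by_contra! hneg
    have h3 := hcoeff (yOrder (f * g * h))
    have h4 : yOrder (f * g * h) < yOrder f + yOrder g := by
      rw [yOrder_mul hfg hh, yOrder_mul hf hg]; omega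
    rw [h1.1 _ h4, h2.1 _ h4, sub_zero, mul_zero, laurentEmb_coeff_yOrder] at h3
    exact yLead_ne_zero (mul_ne_zero hfg hh) h3
  refine ⟨hpos, ?_⟩
  -- The bound `0` is used for `h` instead of its order, so one equation covers both positive order
  -- and order zero.
  have h3 := coeff_mul_add_of_lt (hlow (f * g)) (fun m hm => hlow h m (lt_of_lt_of_le hm hpos))
  rw [← map_mul, add_zero, laurentEmb_coeff_yOrder, yLead_mul] at h3
  rw [← h3.2, hcoeff, yOrder_mul hf hg, h1.2, h2.2]
  simp only [eulerX, eulerY, mapDerivation_coeff, euler_coeff, laurentEmb_coeff_yOrder,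
    residueDerivation, Derivation.smul_apply, smul_eq_mul]
  ring

end Embedding
/-! Leading terms on a pair of generators. -/

section Generators

variable {𝕜 : Type*} [Field 𝕜]

/-- Nested polynomials, in `u` over `𝕜[r]`, separate the variable of positive order from the
coefficients, which will have order zero. -/
lemma exists_poly_of_generates {u r : RatFun2 𝕜} (hgen : Generates u r) (f : RatFun2 𝕜) :
    ∃ P Q : Polynomial (Polynomial 𝕜),
      f = P.eval₂ (Polynomial.aeval r).toRingHom u / Q.eval₂ (Polynomial.aeval r).toRingHom u := by
  have hp : ∀ p : MvPolynomial (Fin 2) 𝕜, ∃ P : Polynomial (Polynomial 𝕜),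
      aeval ![u, r] p = P.eval₂ (Polynomial.aeval r).toRingHom u := by
    intro p
    induction p using MvPolynomial.induction_on with
    | C a => exact ⟨Polynomial.C (Polynomial.C a), by simp [algHom_C]⟩
    | add p q hp hq =>
      obtain ⟨P, hP⟩ := hp
      obtain ⟨Q, hQ⟩ := hq
      exact ⟨P + Q, by rw [map_add, hP, hQ, Polynomial.eval₂_add]⟩
    | mul_X p i hp =>
      obtain ⟨P, hP⟩ := hp
      fin_cases i
      · exact ⟨P * Polynomial.X, by simp [hP]⟩
      · exact ⟨P * Polynomial.C Polynomial.X, by simp [hP, Polynomial.eval₂_mul]⟩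
  have hf : f ∈ IntermediateField.adjoin 𝕜 (Set.range ![u, r]) := by
    rw [hgen _ (IntermediateField.subset_adjoin 𝕜 _ (Set.mem_range_self (0 : Fin 2)))
      (IntermediateField.subset_adjoin 𝕜 _ (Set.mem_range_self (1 : Fin 2)))]
    trivial
  obtain ⟨p, q, h⟩ := (IntermediateField.mem_adjoin_range_iff 𝕜 _ _).1 hf
  obtain ⟨P, hP⟩ := hp p
  obtain ⟨Q, hQ⟩ := hp q
  exact ⟨P, Q, by rw [h, hP, hQ]⟩

variable [CharZero 𝕜]

lemma yOrder_x : yOrder (x 𝕜) = 0 := by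
  simp [yOrder, laurentEmb_x, laurentVar]

lemma yLead_x : yLead (x 𝕜) = HahnSeries.single 1 1 := by
  simp [yLead, laurentEmb_x, laurentVar, HahnSeries.C_apply]

/-- `exists_order_eval₂` is used twice: in `x`, a non-zero polynomial in the residue of `r` does not
vanish, so `c(r)` has `y`-order zero; in `y`, the lowest power of `u` with a non-zero coefficient
then decides. -/
lemma exists_order_of_poly {u r : RatFun2 𝕜} (hu : 0 < yOrder u) (hr : yOrder r = 0)
    (hs : 0 < (yLead r).order) (P : Polynomial (Polynomial 𝕜)) (hP : P ≠ 0) :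
    ∃ i j : ℤ, yOrder (P.eval₂ (Polynomial.aeval r).toRingHom u) = i * yOrder u ∧
      (yLead (P.eval₂ (Polynomial.aeval r).toRingHom u)).order =
        j * (yLead r).order + i * (yLead u).order := by
  set e : Polynomial 𝕜 →+* Laurent2 𝕜 :=
    (laurentEmb 𝕜).toRingHom.comp (Polynomial.aeval r).toRingHom with he_def
  have hu0 : u ≠ 0 := by rintro rfl; simp [yOrder] at hu
  have he_eval : ∀ c, e c =
      c.eval₂ ((HahnSeries.C : HahnSeries ℤ 𝕜 →+* Laurent2 𝕜).comp HahnSeries.C)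
        (laurentEmb 𝕜 r) := by
    intro c
    change laurentEmb 𝕜 (Polynomial.aeval r c) = _
    rw [← Polynomial.aeval_algHom_apply, Polynomial.aeval_def]
    rfl
  have hlead : ∀ c : Polynomial 𝕜, c ≠ 0 → e c ≠ 0 ∧ (e c).order = 0 ∧
      ∃ j : ℤ, ((e c).leadingCoeff).order = j * (yLead r).order := by
    intro c hc
    have h1 := coeff_zero_eval₂ (HahnSeries.C : 𝕜 →+* HahnSeries ℤ 𝕜)
      (r := laurentEmb 𝕜 r) (fun m hm => HahnSeries.coeff_eq_zero_of_lt_order (by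
        change m < yOrder r; rwa [hr])) c
    rw [← he_eval] at h1
    have hr0 : (laurentEmb 𝕜 r).coeff 0 = yLead r := by rw [← hr, laurentEmb_coeff_yOrder]
    rw [hr0] at h1
    obtain ⟨h2, j, -, -, h3, -⟩ := exists_order_eval₂ (HahnSeries.C : 𝕜 →+* HahnSeries ℤ 𝕜)
      (fun c hc => ⟨by simpa using hc, HahnSeries.order_C⟩) hs c hc
    have h0 : (e c).coeff 0 ≠ 0 := by rwa [h1.2]
    have hord : (e c).order = 0 := order_eq_of_coeff h1.1 h0
    refine ⟨fun h => h0 (by rw [h, HahnSeries.coeff_zero]), hord, j, ?_⟩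
    rw [HahnSeries.leadingCoeff_eq, hord, h1.2, h3]
  have heval : laurentEmb 𝕜 (P.eval₂ (Polynomial.aeval r).toRingHom u) =
      P.eval₂ e (laurentEmb 𝕜 u) := Polynomial.hom_eval₂ _ _ (laurentEmb 𝕜).toRingHom _
  obtain ⟨-, i, c, hc, h1, h2, -⟩ :=
    exists_order_eval₂ e (fun c hc => ⟨(hlead c hc).1, (hlead c hc).2.1⟩) hu P hP
  obtain ⟨hc0, -, j, hj⟩ := hlead c hc
  refine ⟨i, j, by rw [yOrder, heval, h1]; rfl, ?_⟩
  rw [yLead, heval, h2]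
  change (_ * yLead u ^ i).order = _
  rw [HahnSeries.order_mul (HahnSeries.leadingCoeff_ne_zero.2 hc0)
    (pow_ne_zero _ (yLead_ne_zero hu0)), hj, HahnSeries.order_pow, nsmul_eq_mul]

/-- Write `x = P/Q`. Since `x` has `y`-order zero, `P` and `Q` have the same lowest power of `u`;
its contribution cancels from the `x`-orders and leaves `1` as a multiple of the order of the
residue of `r`. -/
lemma order_yLead_dvd_one_of_pos {u r : RatFun2 𝕜} (hgen : Generates u r) (hu : 0 < yOrder u)
    (hr : yOrder r = 0) (hs : 0 < (yLead r).order) : (yLead r).order ∣ 1 := by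
  obtain ⟨P, Q, h⟩ := exists_poly_of_generates hgen (x 𝕜)
  have hP0 := div_ne_zero_iff.1 (h ▸ x_ne_zero 𝕜)
  obtain ⟨i, j, h1, h2⟩ := exists_order_of_poly hu hr hs P (by rintro rfl; simp at hP0)
  obtain ⟨i', j', h3, h4⟩ := exists_order_of_poly hu hr hs Q (by rintro rfl; simp at hP0)
  have hx := (eq_div_iff hP0.2).1 h
  have h5 := congrArg yOrder hx
  rw [yOrder_mul (x_ne_zero 𝕜) hP0.2, yOrder_x, h1, h3, zero_add] at h5
  have hi : i' = i := mul_right_cancel₀ hu.ne' h5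
  have h6 := congrArg (fun f => (yLead f).order) hx
  simp only [yLead_mul] at h6
  rw [HahnSeries.order_mul (yLead_ne_zero (x_ne_zero 𝕜)) (yLead_ne_zero hP0.2), yLead_x,
    HahnSeries.order_single one_ne_zero, h2, h4, hi] at h6
  exact ⟨j - j', by linear_combination h6⟩

/-- If `u` has non-zero order and the residue of `r` has non-zero order, then `x` is a rational
function of `u` and `r` only if the latter order is `±1`. -/
lemma order_yLead_dvd_one {u r : RatFun2 𝕜} (hgen : Generates u r) (hu : yOrder u ≠ 0)
    (hr : yOrder r = 0) (hs : (yLead r).order ≠ 0) : (yLead r).order ∣ 1 := by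
  have hinv : ∀ f : RatFun2 𝕜, yOrder f⁻¹ = - yOrder f := fun f => by
    simpa using yOrder_zpow f (-1)
  have hinv' : ∀ f : RatFun2 𝕜, (yLead f⁻¹).order = - (yLead f).order := fun f => by
    have h := yLead_zpow f (-1)
    rw [zpow_neg_one] at h
    rw [h, order_zpow]
    ring
  have h1 : ∀ u r : RatFun2 𝕜, Generates u r → Generates u⁻¹ r := fun u r h E hu hr =>
    h E (by simpa using E.inv_mem hu) hr
  have h2 : ∀ u r : RatFun2 𝕜, Generates u r → Generates u r⁻¹ := fun u r h E hu hr =>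
    h E hu (by simpa using E.inv_mem hr)
  wlog hu' : 0 < yOrder u generalizing u
  · exact this (h1 _ _ hgen) (by rw [hinv]; omega) (by rw [hinv]; omega)
  rcases lt_or_gt_of_ne hs with h | h
  · have := order_yLead_dvd_one_of_pos (h2 _ _ hgen) hu' (by rw [hinv]; omega)
      (by rw [hinv']; omega)
    rwa [hinv', neg_dvd] at this
  · exact order_yLead_dvd_one_of_pos hgen hu' hr h

end Generators
/-! Reduction of pairs of generators whose bracket is a monomial. -/

section Reduction

lemma derivation_zpow {𝕜 L : Type*} [Field 𝕜] [Field L] [Algebra 𝕜 L] (D : Derivation 𝕜 L L)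
    (u : L) (hu : u ≠ 0) (n : ℤ) : D (u ^ n) = n * u ^ n * (D u / u) := by
  rw [Derivation.leibniz_zpow, zpow_sub_one₀ hu]
  simp only [zsmul_eq_mul, smul_eq_mul]
  field_simp

lemma derivation_monomial {𝕜 L : Type*} [Field 𝕜] [Field L] [Algebra 𝕜 L]
    (D : Derivation 𝕜 L L) {u w : L} (hu : u ≠ 0) (hw : w ≠ 0) (m n : ℤ) :
    D (u ^ m * w ^ n) = u ^ m * w ^ n * (m * (D u / u) + n * (D w / w)) := by
  rw [Derivation.leibniz, derivation_zpow D u hu, derivation_zpow D w hw]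
  simp only [smul_eq_mul]
  ring

variable {𝕜 : Type*} [Field 𝕜]

/-- The bracket is bilinear and alternating in logarithmic derivatives, so the exponent matrix
enters through its determinant. -/
lemma flagBracket_monomial {f u w h : RatFun2 𝕜} (hu : u ≠ 0) (hw : w ≠ 0)
    (hb : (flagBracket f).br u w = u * w * h) (a b c d : ℤ) :
    (flagBracket f).br (u ^ a * w ^ b) (u ^ c * w ^ d) =
      ((a * d - b * c : ℤ) : RatFun2 𝕜) * ((u ^ a * w ^ b) * (u ^ c * w ^ d) * h) := by
  simp only [flagBracket, LinearMap.mk₂_apply] at hb ⊢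
  rw [derivation_monomial _ hu hw, derivation_monomial _ hu hw, derivation_monomial _ hu hw,
    derivation_monomial _ hu hw]
  have h1 : h = f * (pd 𝕜 0 u / u * (pd 𝕜 1 w / w) - pd 𝕜 1 u / u * (pd 𝕜 0 w / w)) := by
    field_simp
    linear_combination -hb
  rw [h1]
  push_cast
  ring

lemma flagBracket_sub_const (f u w : RatFun2 𝕜) (c : 𝕜) :
    (flagBracket f).br u (w - algebraMap 𝕜 _ c) = (flagBracket f).br u w := by
  simp [flagBracket]

lemma Generates.zpow_mul_zpow {u w : RatFun2 𝕜} (h : Generates u w) (hu : u ≠ 0) (hw : w ≠ 0)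
    {a b c d : ℤ} (hdet : a * d - b * c = 1) :
    Generates (u ^ a * w ^ b) (u ^ c * w ^ d) ∧
      u = (u ^ a * w ^ b) ^ d * (u ^ c * w ^ d) ^ (-b) ∧
      w = (u ^ a * w ^ b) ^ (-c) * (u ^ c * w ^ d) ^ a := by
  have hmono : ∀ m n : ℤ, (u ^ a * w ^ b) ^ m * (u ^ c * w ^ d) ^ n =
      u ^ (a * m + c * n) * w ^ (b * m + d * n) := by
    intro m n
    rw [mul_zpow, mul_zpow, ← zpow_mul, ← zpow_mul, ← zpow_mul, ← zpow_mul, zpow_add₀ hu,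
      zpow_add₀ hw]
    ring
  have h1 : u = (u ^ a * w ^ b) ^ d * (u ^ c * w ^ d) ^ (-b) := by
    rw [hmono, show a * d + c * -b = 1 by linarith, show b * d + d * -b = 0 by ring]
    simp
  have h2 : w = (u ^ a * w ^ b) ^ (-c) * (u ^ c * w ^ d) ^ a := by
    rw [hmono, show a * -c + c * a = 0 by ring, show b * -c + d * a = 1 by linarith]
    simp
  refine ⟨fun E hU hW => h E ?_ ?_, h1, h2⟩
  · rw [h1]; exact E.mul_mem (zpow_mem hU _) (zpow_mem hW _)
  · rw [h2]; exact E.mul_mem (zpow_mem hU _) (zpow_mem hW _)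

lemma Generates.sub_const {u w : RatFun2 𝕜} (h : Generates u w) (c : 𝕜) :
    Generates u (w - algebraMap 𝕜 _ c) := fun E hu hw => h E hu (by
  simpa using E.add_mem hw (E.algebraMap_mem c))

lemma residueDerivation_coeff (q : 𝕜) (n : ℕ) (a : HahnSeries ℤ 𝕜) (m : ℤ) :
    (residueDerivation 𝕜 q n a).coeff (m + n) = q * (m * a.coeff m) := by
  rw [residueDerivation, Derivation.smul_apply, smul_eq_mul, mul_comm,
    HahnSeries.coeff_mul_single_add, euler_coeff, mul_comm]

variable [CharZero 𝕜]

instance hahnSeriesCharZero : CharZero (HahnSeries ℤ 𝕜) :=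
  charZero_of_injective_algebraMap (algebraMap 𝕜 (HahnSeries ℤ 𝕜)).injective

lemma eq_C_of_residueDerivation_eq_zero {q : 𝕜} (hq : q ≠ 0) {n : ℕ} {a : HahnSeries ℤ 𝕜}
    (h : residueDerivation 𝕜 q n a = 0) : a = HahnSeries.C (a.coeff 0) := by
  rw [residueDerivation, Derivation.smul_apply, smul_eq_mul, mul_eq_zero] at h
  exact eq_C_of_euler_eq_zero (h.resolve_left (by simpa using hq))

lemma laurentEmb_coeff_zero {r : RatFun2 𝕜} (hr : yOrder r = 0) :
    (laurentEmb 𝕜 r).coeff 0 = yLead r := by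
  rw [← hr, laurentEmb_coeff_yOrder]

lemma laurentEmb_sub_const_coeff (r : RatFun2 𝕜) (c : 𝕜) :
    (∀ m < 0, (laurentEmb 𝕜 (r - algebraMap 𝕜 _ c)).coeff m = (laurentEmb 𝕜 r).coeff m) ∧
      (laurentEmb 𝕜 (r - algebraMap 𝕜 _ c)).coeff 0 =
        (laurentEmb 𝕜 r).coeff 0 - HahnSeries.C c := by
  have h : laurentEmb 𝕜 (r - algebraMap 𝕜 _ c) =
      laurentEmb 𝕜 r - HahnSeries.single 0 (HahnSeries.C c) := by
    rw [map_sub, AlgHom.commutes]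
    rfl
  rw [h]
  exact ⟨fun m hm => by simp [HahnSeries.coeff_single_of_ne hm.ne], by simp⟩

lemma yLead_sub_const {r : RatFun2 𝕜} (hr : yOrder r = 0) {c : 𝕜}
    (hc : yLead r - HahnSeries.C c ≠ 0) :
    yOrder (r - algebraMap 𝕜 _ c) = 0 ∧
      yLead (r - algebraMap 𝕜 _ c) = yLead r - HahnSeries.C c := by
  obtain ⟨h1, h2⟩ := laurentEmb_sub_const_coeff r c
  rw [laurentEmb_coeff_zero hr] at h2
  have h3 : yOrder (r - algebraMap 𝕜 _ c) = 0 := order_eq_of_coeff (fun m hm => by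
    rw [h1 m hm]
    exact HahnSeries.coeff_eq_zero_of_lt_order (by change m < yOrder r; rwa [hr]))
    (by rwa [h2])
  exact ⟨h3, by rw [← laurentEmb_coeff_zero h3, h2]⟩

lemma yOrder_sub_const_pos {r : RatFun2 𝕜} (hr : yOrder r = 0) {c : 𝕜}
    (hc : yLead r = HahnSeries.C c) (hne : r - algebraMap 𝕜 _ c ≠ 0) :
    0 < yOrder (r - algebraMap 𝕜 _ c) := by
  obtain ⟨h1, h2⟩ := laurentEmb_sub_const_coeff r c
  rw [laurentEmb_coeff_zero hr, hc, sub_self] at h2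
  by_contra! hle
  have h3 : (laurentEmb 𝕜 (r - algebraMap 𝕜 _ c)).coeff (yOrder (r - algebraMap 𝕜 _ c)) = 0 := by
    rcases hle.lt_or_eq with h | h
    · rw [h1 _ h]
      exact HahnSeries.coeff_eq_zero_of_lt_order (by change _ < yOrder r; rwa [hr])
    · rw [h, h2]
  rw [laurentEmb_coeff_yOrder] at h3
  exact yLead_ne_zero hne h3

/-- A residue on which `q xⁿ⁺¹ d/dx` is constant generates the residue field only if `n = 1`. -/
lemma eq_one_of_residueDerivation_const {q : 𝕜} (hq : q ≠ 0) {n : ℕ} {u r : RatFun2 𝕜}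
    (hgen : Generates u r) (hu : yOrder u ≠ 0) (hr : yOrder r = 0) {c : 𝕜} (hc : c ≠ 0)
    (h : residueDerivation 𝕜 q n (yLead r) = HahnSeries.C c) : n = 1 := by
  have h1 : ∀ m : ℤ, q * (m * (yLead r).coeff m) = (HahnSeries.C c).coeff (m + n) := by
    intro m
    rw [← h, residueDerivation_coeff]
  -- Degree `-n` is the only one sent to degree zero. For `n = 0` the factor `m` vanishes there,
  -- contradicting `c ≠ 0`.
  have h2 := h1 (-n)
  rw [neg_add_cancel, HahnSeries.C_apply, HahnSeries.coeff_single_same] at h2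
  have hn : n ≠ 0 := by
    rintro rfl
    exact hc (by rw [← h2]; simp)
  have hn' : (-n : ℤ) ≠ 0 := by omega
  have h3 : (yLead r).coeff (-n) ≠ 0 := fun h0 => hc (by rw [← h2, h0]; simp)
  -- Up to its constant term, the residue is a multiple of `x⁻ⁿ`.
  have h4 : ∀ m : ℤ, (yLead r - HahnSeries.C ((yLead r).coeff 0)).coeff m =
      if m = -n then (yLead r).coeff (-n) else 0 := by
    intro m
    rw [HahnSeries.coeff_sub, HahnSeries.C_apply]
    split_ifs with hm
    · rw [hm, HahnSeries.coeff_single_of_ne hn', sub_zero]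
    · by_cases hm0 : m = 0
      · simp [hm0]
      · have h5 := h1 m
        rw [HahnSeries.C_apply, HahnSeries.coeff_single_of_ne (by omega)] at h5
        have hmk : (m : 𝕜) ≠ 0 := by exact_mod_cast hm0
        rw [HahnSeries.coeff_single_of_ne hm0, sub_zero]
        simpa [hq, hmk] using h5
  have h5 : (yLead r - HahnSeries.C ((yLead r).coeff 0)).order = (-n : ℤ) :=
    order_eq_of_coeff (fun m hm => by rw [h4, if_neg hm.ne]) (by rwa [h4, if_pos rfl])
  have h6 : yLead r - HahnSeries.C ((yLead r).coeff 0) ≠ 0 := by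
    intro h0
    rw [h0, HahnSeries.order_zero] at h5
    exact hn' h5.symm
  obtain ⟨h7, h8⟩ := yLead_sub_const hr h6
  have h9 := order_yLead_dvd_one (hgen.sub_const _) hu h7 (by rw [h8, h5]; exact hn')
  rw [h8, h5, neg_dvd] at h9
  exact_mod_cast Int.eq_one_of_dvd_one (by positivity) h9

/-- One blow-up: a monomial change of variables followed by a translation. -/
lemma exists_blowup {q : 𝕜} (hq : q ≠ 0) {n : ℕ} {u w f : RatFun2 𝕜} {i j : ℤ} {c : 𝕜}
    (hu : u ≠ 0) (hw : w ≠ 0) (hf : f ≠ 0) (hgen : Generates u w)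
    (hb : (scaledPowField q n).br u w = u * w * (u ^ i * w ^ j * f))
    (hord : 0 < yOrder (u ^ i * w ^ j * f)) (hf0 : yOrder f = 0)
    (hfc : yLead f = HahnSeries.C c) :
    ∃ (u' w' f' : RatFun2 𝕜) (k : ℤ) (c' : 𝕜), u' ≠ 0 ∧ w' ≠ 0 ∧ f' ≠ 0 ∧ Generates u' w' ∧
      (scaledPowField q n).br u' w' = u' * w' * (u' ^ k * w' ^ (-1 : ℤ) * f') ∧
      yOrder f' = 0 ∧ yLead f' = HahnSeries.C c' ∧
      yOrder (u' ^ k * w' ^ (-1 : ℤ) * f') < yOrder (u ^ i * w ^ j * f) := by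
  set h := u ^ i * w ^ j * f with hdef
  have hh : h ≠ 0 := mul_ne_zero (mul_ne_zero (zpow_ne_zero _ hu) (zpow_ne_zero _ hw)) hf
  have hA := (residueDerivation_yLead hu hw hh hb).2
  rw [HahnSeries.coeff_eq_zero_of_lt_order (show 0 < (laurentEmb 𝕜 h).order from hord),
    mul_zero] at hA
  have hd : 0 < Int.gcd (yOrder u) (yOrder w) := by
    rw [Int.gcd_pos_iff]
    by_contra! h0
    rw [hdef, yOrder_mul (mul_ne_zero (zpow_ne_zero _ hu) (zpow_ne_zero _ hw)) hf,
      yOrder_mul (zpow_ne_zero _ hu) (zpow_ne_zero _ hw), yOrder_zpow, yOrder_zpow, h0.1, h0.2,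
      hf0] at hord
    simp at hord
  -- Dividing the orders of `u`, `w` by their gcd gives `g'`, `h'`. The monomial `W = u ^ (-h') * w
  -- ^ g'` has order zero, and the Bézout coefficients give a complementary monomial `U`.
  obtain ⟨g', h', hcop, hg, hh'⟩ := Int.exists_gcd_one hd
  obtain ⟨α, β, hαβ⟩ := Int.isCoprime_iff_gcd_eq_one.2 hcop
  set d := Int.gcd (yOrder u) (yOrder w)
  have hdet : α * g' - β * (-h') = 1 := by linarith
  obtain ⟨hgen', hu', hw'⟩ := hgen.zpow_mul_zpow hu hw hdet
  have hb' := flagBracket_monomial hu hw hb α β (-h') g'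
  rw [hdet, Int.cast_one, one_mul] at hb'
  set U := u ^ α * w ^ β with hU
  set W := u ^ (-h') * w ^ g' with hW
  have hU0 : U ≠ 0 := mul_ne_zero (zpow_ne_zero _ hu) (zpow_ne_zero _ hw)
  have hW0 : W ≠ 0 := mul_ne_zero (zpow_ne_zero _ hu) (zpow_ne_zero _ hw)
  have hWord : yOrder W = 0 := by
    rw [hW, yOrder_mul (zpow_ne_zero _ hu) (zpow_ne_zero _ hw), yOrder_zpow, yOrder_zpow, hg, hh']
    ring
  have ha := yLead_ne_zero hu
  have hb0 := yLead_ne_zero hw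
  -- Positive order of `h` makes the right side of the leading-term equation zero, which says
  -- exactly that the logarithmic derivative of this residue vanishes.
  have hWder : residueDerivation 𝕜 q n (yLead W) = 0 := by
    rw [hW, yLead_mul, yLead_zpow, yLead_zpow, derivation_monomial _ ha hb0]
    have hdF : (d : HahnSeries ℤ 𝕜) ≠ 0 := by exact_mod_cast hd.ne'
    rw [hg, hh'] at hA
    push_cast at hA ⊢
    have h0 : (-h' : HahnSeries ℤ 𝕜) * (residueDerivation 𝕜 q n (yLead u) / yLead u) +
        g' * (residueDerivation 𝕜 q n (yLead w) / yLead w) = 0 := by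
      apply mul_left_cancel₀ (mul_ne_zero hdF (mul_ne_zero ha hb0))
      rw [mul_zero, ← neg_eq_zero, ← hA]
      field_simp
      ring
    rw [h0, mul_zero]
  have hWC := eq_C_of_residueDerivation_eq_zero hq hWder
  set μ := (yLead W).coeff 0
  set V := W - algebraMap 𝕜 _ μ with hV
  have hbV : (scaledPowField q n).br U V = U * W * h := by
    rw [hV, scaledPowField, flagBracket_sub_const]
    exact hb'
  have hV0 : V ≠ 0 := by
    intro h0
    rw [h0, map_zero] at hbV
    exact mul_ne_zero (mul_ne_zero hU0 hW0) hh hbV.symm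
  clear_value U W
  have hhUW : h = U ^ (i * g' + j * h') * W ^ (j * α - i * β) * f := by
    rw [hdef]
    conv_lhs => rw [hu', hw']
    rw [mul_zpow, mul_zpow, ← zpow_mul, ← zpow_mul, ← zpow_mul, ← zpow_mul, sub_eq_add_neg,
      zpow_add₀ hU0, zpow_add₀ hW0]
    rw [show -β * i = -(i * β) by ring, show -(-h') * j = j * h' by ring, mul_comm g' i,
      mul_comm α j]
    ring
  -- The new quotient `{U, V}/(U V)` is `W h / V`: its order drops by that of `V`. Powers of `W`
  -- have order zero and constant residue, so they join the factor `f'`.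
  have hnew : U ^ (i * g' + j * h') * V ^ (-1 : ℤ) * (W ^ (1 + (j * α - i * β)) * f) =
      W * h * V ^ (-1 : ℤ) := by
    rw [hhUW, zpow_add₀ hW0, zpow_one]
    ring
  have hVpos := yOrder_sub_const_pos hWord hWC hV0
  refine ⟨U, V, W ^ (1 + (j * α - i * β)) * f, i * g' + j * h', μ ^ (1 + (j * α - i * β)) * c,
    hU0, hV0, mul_ne_zero (zpow_ne_zero _ hW0) hf, hgen'.sub_const μ, ?_, ?_, ?_, ?_⟩
  · rw [hnew, hbV]
    field_simp
  · rw [yOrder_mul (zpow_ne_zero _ hW0) hf, yOrder_zpow, hWord, hf0]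
    simp
  · rw [yLead_mul, yLead_zpow, hWC, hfc, ← map_zpow₀, ← map_mul]
  · rw [hnew, yOrder_mul (mul_ne_zero hW0 hh) (zpow_ne_zero _ hV0), yOrder_mul hW0 hh,
      yOrder_zpow, hWord]
    linarith

/-- Generators `u`, `w` with `{u, w} = uᵏ⁺¹ f`, where `f` has constant residue, exist only for
`n = 1`. -/
lemma eq_one_of_bracket_eq_pow {q : 𝕜} (hq : q ≠ 0) {n : ℕ} :
    ∀ (N : ℕ) {u w f : RatFun2 𝕜} {k : ℤ} {c : 𝕜}, u ≠ 0 → w ≠ 0 → f ≠ 0 → Generates u w →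
    (scaledPowField q n).br u w = u * w * (u ^ k * w ^ (-1 : ℤ) * f) →
    yOrder f = 0 → yLead f = HahnSeries.C c → yOrder (u ^ k * w ^ (-1 : ℤ) * f) ≤ N → n = 1 := by
  intro N
  induction N using Nat.strong_induction_on with
  | _ N ih =>
    intro u w f k c hu hw hf hgen hb hf0 hfc hN
    have hh : u ^ k * w ^ (-1 : ℤ) * f ≠ 0 :=
      mul_ne_zero (mul_ne_zero (zpow_ne_zero _ hu) (zpow_ne_zero _ hw)) hf
    obtain ⟨hnonneg, hA⟩ := residueDerivation_yLead hu hw hh hb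
    rcases hnonneg.lt_or_eq with hpos | hzero
    · obtain ⟨u', w', f', k', c', hu', hw', hf', hgen', hb', hf0', hfc', hlt⟩ :=
        exists_blowup hq hu hw hf hgen hb hpos hf0 hfc
      have hnn := (residueDerivation_yLead hu' hw' (mul_ne_zero (mul_ne_zero
        (zpow_ne_zero _ hu') (zpow_ne_zero _ hw')) hf') hb').1
      exact ih (yOrder (u' ^ k' * w' ^ (-1 : ℤ) * f')).toNat (by omega) hu' hw' hf' hgen' hb'
        hf0' hfc' (by omega)
    · have hc : c ≠ 0 := by
        rintro rfl
        exact yLead_ne_zero hf (by rw [hfc, map_zero])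
      have ha := yLead_ne_zero hu
      have hb0 := yLead_ne_zero hw
      rw [laurentEmb_coeff_zero hzero.symm, yLead_mul, yLead_mul, yLead_zpow, yLead_zpow,
        hfc] at hA
      have horder : k * yOrder u = yOrder w := by
        rw [yOrder_mul (mul_ne_zero (zpow_ne_zero _ hu) (zpow_ne_zero _ hw)) hf,
          yOrder_mul (zpow_ne_zero _ hu) (zpow_ne_zero _ hw), yOrder_zpow, yOrder_zpow, hf0]
          at hzero
        linarith
      have hCc : (HahnSeries.C c : HahnSeries ℤ 𝕜) ≠ 0 := by simpa using hc
      -- If `u` had order zero, so would `w`, and the left side of the leading-term equation would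
      -- vanish.
      have hg : yOrder u ≠ 0 := by
        intro hg
        rw [← horder, hg] at hA
        simp only [mul_zero, Int.cast_zero, zero_mul, sub_zero] at hA
        exact mul_ne_zero (mul_ne_zero ha hb0) (mul_ne_zero (mul_ne_zero (zpow_ne_zero _ ha)
          (zpow_ne_zero _ hb0)) hCc) hA.symm
      have hgk : (yOrder u : 𝕜) ≠ 0 := by exact_mod_cast hg
      have hgF : (yOrder u : HahnSeries ℤ 𝕜) ≠ 0 := by exact_mod_cast hg
      have hdet : (1 : ℤ) * 1 - 0 * (-k) = 1 := by ring
      have hgen' := (hgen.zpow_mul_zpow hu hw hdet).1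
      rw [zpow_one, zpow_zero, mul_one, zpow_one] at hgen'
      -- Since `ord w = k ord u`, the element `u⁻ᵏ w` has order zero; dividing the leading-term
      -- equation by `ord u` gives `δ` of its residue as `-c / ord u`.
      refine eq_one_of_residueDerivation_const (c := -c / yOrder u) hq (r := u ^ (-k) * w) hgen' hg
        ?_ (div_ne_zero (neg_ne_zero.2 hc) hgk) ?_
      · rw [yOrder_mul (zpow_ne_zero _ hu) hw, yOrder_zpow]
        linarith
      · have hmon := derivation_monomial (residueDerivation 𝕜 q n) ha hb0 (-k) 1
        rw [zpow_one] at hmon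
        rw [yLead_mul, yLead_zpow, hmon, map_div₀, map_neg, map_intCast]
        rw [← horder] at hA
        push_cast at hA ⊢
        rw [zpow_neg_one] at hA
        rw [zpow_neg]
        have hak : yLead u ^ k ≠ 0 := zpow_ne_zero _ ha
        field_simp at hA ⊢
        linear_combination -hA

end Reduction
/-! Isomorphisms of Poisson fields. -/

section PoissonIsoLemmas

variable {𝕜 : Type*} [Field 𝕜]

lemma PoissonIso.refl {A : Type*} [CommRing A] [Algebra 𝕜 A] (B : PoissonBracket 𝕜 A) :
    PoissonIso B B := ⟨AlgEquiv.refl, fun _ _ => rfl⟩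

lemma PoissonIso.symm {A A' : Type*} [CommRing A] [Algebra 𝕜 A] [CommRing A'] [Algebra 𝕜 A']
    {B : PoissonBracket 𝕜 A} {B' : PoissonBracket 𝕜 A'} (h : PoissonIso B B') :
    PoissonIso B' B := by
  obtain ⟨φ, hφ⟩ := h
  exact ⟨φ.symm, fun a b => by rw [AlgEquiv.symm_apply_eq, hφ]; simp⟩

lemma PoissonIso.trans {A A' A'' : Type*} [CommRing A] [Algebra 𝕜 A] [CommRing A'] [Algebra 𝕜 A']
    [CommRing A''] [Algebra 𝕜 A''] {B : PoissonBracket 𝕜 A} {B' : PoissonBracket 𝕜 A'}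
    {B'' : PoissonBracket 𝕜 A''} (h : PoissonIso B B') (h' : PoissonIso B' B'') :
    PoissonIso B B'' := by
  obtain ⟨φ, hφ⟩ := h
  obtain ⟨ψ, hψ⟩ := h'
  exact ⟨φ.trans ψ, fun a b => by simp [hφ, hψ]⟩

/-- An isomorphism from `K{f}` yields generators with the same bracket. -/
lemma PoissonIso.exists_generators {f : RatFun2 𝕜} {B : PoissonBracket 𝕜 (RatFun2 𝕜)}
    (h : PoissonIso (flagBracket f) B) :
    ∃ φ : RatFun2 𝕜 ≃ₐ[𝕜] RatFun2 𝕜, Generates (φ (x 𝕜)) (φ (y 𝕜)) ∧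
      B.br (φ (x 𝕜)) (φ (y 𝕜)) = φ f := by
  obtain ⟨φ, hφ⟩ := h
  refine ⟨φ, fun E hx hy => ?_, by rw [← hφ, flagBracket_x_y]⟩
  have h1 : E.comap φ.toAlgHom = ⊤ := generates_x_y 𝕜 _ hx hy
  rw [eq_top_iff]
  rintro a -
  have h2 : φ.symm a ∈ E.comap φ.toAlgHom := by rw [h1]; trivial
  have h3 : φ (φ.symm a) ∈ E := h2
  rwa [φ.apply_symm_apply] at h3

/-- Generators `u`, `w` with `{u, w} = f(u, w)` give an isomorphism from `K{f}`. -/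
lemma poissonIso_of_generates [CharZero 𝕜] {f g u w : RatFun2 𝕜} (hgen : Generates u w)
    (hne : (flagBracket g).br u w ≠ 0)
    (hf : ∀ φ : RatFun2 𝕜 →ₐ[𝕜] RatFun2 𝕜, φ (x 𝕜) = u → φ (y 𝕜) = w →
      φ f = (flagBracket g).br u w) :
    PoissonIso (flagBracket f) (flagBracket g) := by
  -- A non-zero bracket means a non-zero Jacobian.
  have hinj : Function.Injective
      (aeval ![u, w] : MvPolynomial (Fin 2) 𝕜 →ₐ[𝕜] RatFun2 𝕜) := by
    apply aeval_injective_of_jacobian (pd 𝕜 0) (pd 𝕜 1)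
    intro h0
    apply hne
    simp only [Matrix.cons_val_zero, Matrix.cons_val_one] at h0
    simp only [flagBracket, LinearMap.mk₂_apply, h0, mul_zero]
  let φ₀ : RatFun2 𝕜 →ₐ[𝕜] RatFun2 𝕜 := IsFractionRing.liftAlgHom hinj
  have hx : φ₀ (x 𝕜) = u := by simp [φ₀, x, IsFractionRing.liftAlgHom_apply]
  have hy : φ₀ (y 𝕜) = w := by simp [φ₀, y, IsFractionRing.liftAlgHom_apply]
  have hsurj : Function.Surjective φ₀ := by
    intro a
    have h1 : φ₀.fieldRange = ⊤ := hgen _ ⟨_, hx⟩ ⟨_, hy⟩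
    have h2 : a ∈ φ₀.fieldRange := by rw [h1]; trivial
    exact h2
  let φ : RatFun2 𝕜 ≃ₐ[𝕜] RatFun2 𝕜 := AlgEquiv.ofBijective φ₀ ⟨φ₀.injective, hsurj⟩
  have hφx : φ (x 𝕜) = u := hx
  have hφy : φ (y 𝕜) = w := hy
  have hsmul : ∀ (ψ : RatFun2 𝕜 ≃ₐ[𝕜] RatFun2 𝕜) (c : 𝕜) (a : RatFun2 𝕜), ψ (c • a) = c • ψ a :=
    fun ψ c a => by rw [Algebra.smul_def, map_mul, AlgEquiv.commutes, Algebra.smul_def]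
  -- The bracket of `K{g}` pulled back along `φ` takes the value `f` on `x`, `y`, so uniqueness
  -- identifies it with that of `K{f}`.
  let B : PoissonBracket 𝕜 (RatFun2 𝕜) :=
    { br := LinearMap.mk₂ 𝕜 (fun a b => φ.symm ((flagBracket g).br (φ a) (φ b)))
        (fun a a' b => by simp)
        (fun c a b => by
          rw [hsmul φ, map_smul, LinearMap.smul_apply, hsmul φ.symm])
        (fun a b b' => by simp)
        (fun c a b => by rw [hsmul φ, map_smul, hsmul φ.symm])
      br_self := fun a => by rw [LinearMap.mk₂_apply, PoissonBracket.br_self, map_zero]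
      leibniz := fun a b c => by
        simp only [LinearMap.mk₂_apply, map_mul, PoissonBracket.leibniz, map_add,
          AlgEquiv.symm_apply_apply]
      jacobi := fun a b c => by
        simp only [LinearMap.mk₂_apply, AlgEquiv.apply_symm_apply]
        rw [← map_add, ← map_add, PoissonBracket.jacobi, map_zero] }
  have hB : B = flagBracket f := by
    apply eq_flagBracket
    change φ.symm ((flagBracket g).br (φ (x 𝕜)) (φ (y 𝕜))) = f
    rw [AlgEquiv.symm_apply_eq, hφx, hφy]
    exact (hf φ₀ hx hy).symm
  refine ⟨φ, fun a b => ?_⟩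
  rw [← hB]
  exact φ.apply_symm_apply _

lemma qSkewField_eq (q : 𝕜) : qSkewField q = scaledPowField q 0 := by
  simp [qSkewField, scaledPowField]

lemma powField_eq (n : ℕ) : powField 𝕜 n = scaledPowField 1 n := by
  simp [powField, scaledPowField]

lemma qSkewField_eq_monomialField (q : 𝕜) : qSkewField q = monomialField q 1 1 := by
  simp [qSkewField, monomialField]

lemma scaledPowField_x_y_ne_zero {q : 𝕜} (hq : q ≠ 0) (n : ℕ) :
    algebraMap 𝕜 (RatFun2 𝕜) q * x 𝕜 ^ (n + 1) * y 𝕜 ≠ 0 :=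
  mul_ne_zero (mul_ne_zero (by simpa using hq) (pow_ne_zero _ (x_ne_zero 𝕜))) (y_ne_zero 𝕜)

/-- No field `K{f}` with `f ≠ 0` is isomorphic to `K{0}`. -/
lemma not_poissonIso_qSkewField_zero {f : RatFun2 𝕜} (hf : f ≠ 0) :
    ¬ PoissonIso (flagBracket f) (qSkewField 0) := by
  intro h
  obtain ⟨φ, -, h2⟩ := h.exists_generators
  have h3 : φ f = 0 := by rw [← h2]; simp [qSkewField, flagBracket]
  exact hf (by simpa using h3)

/-! ### Non-isomorphism from leading terms. -/

variable [CharZero 𝕜]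

/-- The relation `{u, w} = 1` is the case `k = -1`, `f = 1` of `eq_one_of_bracket_eq_pow`. -/
lemma not_poissonIso_weylField {q : 𝕜} (hq : q ≠ 0) {n : ℕ} (hn : n ≠ 1) :
    ¬ PoissonIso (weylField 𝕜) (scaledPowField q n) := by
  intro h
  obtain ⟨φ, hgen, hb⟩ := h.exists_generators
  have hu : φ (x 𝕜) ≠ 0 := by simpa using x_ne_zero 𝕜
  have hw : φ (y 𝕜) ≠ 0 := by simpa using y_ne_zero 𝕜
  set u := φ (x 𝕜)
  set w := φ (y 𝕜)
  have h1 : yOrder (1 : RatFun2 𝕜) = 0 := by simp [yOrder]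
  have h2 : yLead (1 : RatFun2 𝕜) = HahnSeries.C 1 := by simp [yLead]
  refine hn (eq_one_of_bracket_eq_pow hq _ hu hw one_ne_zero hgen (k := -1) ?_ h1 h2
    (Int.self_le_toNat _))
  rw [hb, map_one]
  field_simp

/-- Here `h = uᵐ`. Positive order leads through one blow-up to `n = 1`; at order zero the residue
`a` of `u` satisfies `ord(w) δ(a) = aᵐ⁺¹`, and comparing `x`-orders gives `m = n`. -/
lemma eq_of_poissonIso_powField {q : 𝕜} (hq : q ≠ 0) {m n : ℕ} (hm : 1 ≤ m)
    (h : PoissonIso (powField 𝕜 m) (scaledPowField q n)) : n = 1 ∨ m = n := by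
  obtain ⟨φ, hgen, hb⟩ := h.exists_generators
  have hu : φ (x 𝕜) ≠ 0 := by simpa using x_ne_zero 𝕜
  have hw : φ (y 𝕜) ≠ 0 := by simpa using y_ne_zero 𝕜
  rw [map_mul, map_pow] at hb
  set u := φ (x 𝕜)
  set w := φ (y 𝕜)
  have h1 : yOrder (1 : RatFun2 𝕜) = 0 := by simp [yOrder]
  have h2 : yLead (1 : RatFun2 𝕜) = HahnSeries.C 1 := by simp [yLead]
  have hb' : (scaledPowField q n).br u w = u * w * (u ^ (m : ℤ) * w ^ (0 : ℤ) * 1) := by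
    rw [hb, zpow_natCast, zpow_zero]
    ring
  have hh : u ^ (m : ℤ) * w ^ (0 : ℤ) * 1 ≠ 0 := by simpa using fun h0 => absurd h0 hu
  obtain ⟨hnonneg, hA⟩ := residueDerivation_yLead hu hw hh hb'
  rcases hnonneg.lt_or_eq with hpos | hzero
  · left
    obtain ⟨u', w', f', k', c', hu', hw', hf', hgen', hb', hf0', hfc', hlt⟩ :=
      exists_blowup hq hu hw one_ne_zero hgen hb' hpos h1 h2
    exact eq_one_of_bracket_eq_pow hq _ hu' hw' hf' hgen' hb' hf0' hfc' (Int.self_le_toNat _)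
  · right
    have ha := yLead_ne_zero hu
    have hb0 := yLead_ne_zero hw
    rw [laurentEmb_coeff_zero hzero.symm] at hA
    simp only [zpow_natCast, zpow_zero, mul_one] at hA hzero
    have hu0 : yOrder u = 0 := by
      rw [← zpow_natCast, yOrder_zpow] at hzero
      have : (m : ℤ) ≠ 0 := by omega
      exact (mul_eq_zero.1 hzero.symm).resolve_left this
    rw [hu0, ← zpow_natCast, yLead_zpow, zpow_natCast] at hA
    have hA' : residueDerivation 𝕜 q n (yLead u) * HahnSeries.C (yOrder w : 𝕜) =
        yLead u ^ (m + 1) := by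
      apply mul_right_cancel₀ hb0
      rw [map_intCast]
      push_cast at hA
      linear_combination hA
    set a := yLead u
    set s := a.order with hs
    have hcoeff : ∀ j : ℤ, q * (j * a.coeff j) * yOrder w = (a ^ (m + 1)).coeff (j + n) := by
      intro j
      rw [← hA', HahnSeries.C_apply, HahnSeries.coeff_mul_single_zero, residueDerivation_coeff]
    have hpow : (a ^ (m + 1)).order = (m + 1) * s := by
      rw [HahnSeries.order_pow, nsmul_eq_mul]
      push_cast
      rfl
    have htop : (a ^ (m + 1)).coeff ((m + 1) * s) ≠ 0 := by
      rw [← hpow, Ne, HahnSeries.coeff_order_eq_zero]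
      exact pow_ne_zero _ ha
    -- The lowest term of `aᵐ⁺¹` is non-zero, so `w` has non-zero order and `δ(a)` has a term there;
    -- this rules out `s = 0`.
    have h3 := hcoeff ((m + 1) * s - n)
    rw [sub_add_cancel] at h3
    rw [← h3] at htop
    have hw0 : (yOrder w : 𝕜) ≠ 0 := right_ne_zero_of_mul htop
    have h4 := right_ne_zero_of_mul (left_ne_zero_of_mul htop)
    have h5 : (m + 1) * s - n ≠ 0 := by exact_mod_cast left_ne_zero_of_mul h4
    have h6 : s ≤ (m + 1) * s - n :=
      HahnSeries.order_le_of_coeff_ne_zero (right_ne_zero_of_mul h4)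
    have h7 : s ≠ 0 := by
      intro h0
      rw [h0] at h5 h6
      omega
    -- As `s ≠ 0`, the lowest term of `a` survives under `δ`; the two inequalities give `m s = n`.
    have h8 : (a ^ (m + 1)).coeff (s + n) ≠ 0 := by
      rw [← hcoeff]
      refine mul_ne_zero (mul_ne_zero hq (mul_ne_zero (by exact_mod_cast h7) ?_)) hw0
      rw [hs, Ne, HahnSeries.coeff_order_eq_zero]
      exact ha
    have h9 := HahnSeries.order_le_of_coeff_ne_zero h8
    rw [hpow] at h9
    have h10 : m * s = n := by linarith
    have hdvd := order_yLead_dvd_one (fun E hw hu => hgen E hu hw)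
      (by exact_mod_cast hw0) hu0 h7
    have h11 : 0 ≤ s := by
      by_contra! hneg
      have : (m : ℤ) * s < 0 := mul_neg_of_pos_of_neg (by exact_mod_cast hm) hneg
      omega
    have h12 : s = 1 := Int.eq_one_of_dvd_one h11 hdvd
    rw [h12, mul_one] at h10
    exact_mod_cast h10

/-- For `n = 0`, `δ = q x d/dx` multiplies a lowest term by `q` times its order. The integer is the
determinant of the `x`- and `y`-orders of the two generators. -/
lemma exists_int_of_poissonIso_qSkewField {p q : 𝕜} (hp : p ≠ 0)
    (h : PoissonIso (qSkewField p) (qSkewField q)) : ∃ z : ℤ, p = q * z := by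
  obtain ⟨φ, -, hb⟩ := h.exists_generators
  have hu : φ (x 𝕜) ≠ 0 := by simpa using x_ne_zero 𝕜
  have hw : φ (y 𝕜) ≠ 0 := by simpa using y_ne_zero 𝕜
  rw [map_mul, map_mul, AlgEquiv.commutes] at hb
  set u := φ (x 𝕜)
  set w := φ (y 𝕜)
  have hb' : (scaledPowField q 0).br u w = u * w * algebraMap 𝕜 _ p := by
    rw [← qSkewField_eq, hb]
    ring
  have hA := (residueDerivation_yLead hu hw (by simpa using hp) hb').2
  have hp0 : (laurentEmb 𝕜 (algebraMap 𝕜 _ p)).coeff 0 = HahnSeries.C p := by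
    rw [AlgHom.commutes]
    exact HahnSeries.coeff_single_same _ _
  rw [hp0] at hA
  have ha := yLead_ne_zero hu
  have hb0 := yLead_ne_zero hw
  set a := yLead u
  set b := yLead w
  have hlow : ∀ (a : HahnSeries ℤ 𝕜), ∀ m < a.order, a.coeff m = 0 :=
    fun a m hm => HahnSeries.coeff_eq_zero_of_lt_order hm
  have hδ : ∀ (a : HahnSeries ℤ 𝕜) (m : ℤ),
      (residueDerivation 𝕜 q 0 a).coeff m = q * (m * a.coeff m) := by
    intro a m
    simpa using residueDerivation_coeff q 0 a m
  have hδlow : ∀ (a : HahnSeries ℤ 𝕜), ∀ m < a.order, (residueDerivation 𝕜 q 0 a).coeff m = 0 :=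
    fun a m hm => by rw [hδ, hlow a m hm, mul_zero, mul_zero]
  have h1 := (coeff_mul_add_of_lt (hδlow a) (hlow b)).2
  have h2 := (coeff_mul_add_of_lt (hlow a) (hδlow b)).2
  have h3 := (coeff_mul_add_of_lt (hlow a) (hlow b)).2
  have h4 := congrArg (fun f => HahnSeries.coeff f (a.order + b.order))
    (show HahnSeries.C (yOrder w : 𝕜) * (residueDerivation 𝕜 q 0 a * b) -
      HahnSeries.C (yOrder u : 𝕜) * (a * residueDerivation 𝕜 q 0 b) =
        HahnSeries.C p * (a * b) by
      rw [map_intCast, map_intCast]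
      linear_combination hA)
  simp only [HahnSeries.coeff_sub, HahnSeries.C_apply, HahnSeries.coeff_single_zero_mul] at h4
  rw [h1, h2, h3, hδ, hδ] at h4
  have hac : a.coeff a.order ≠ 0 := fun h => ha (HahnSeries.coeff_order_eq_zero.1 h)
  have hbc : b.coeff b.order ≠ 0 := fun h => hb0 (HahnSeries.coeff_order_eq_zero.1 h)
  refine ⟨yOrder w * a.order - yOrder u * b.order, ?_⟩
  apply mul_right_cancel₀ (mul_ne_zero hac hbc)
  push_cast
  linear_combination -h4

/-! ### Explicit isomorphisms and the classification of monomial brackets. -/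

lemma poissonIso_qSkewField_neg {q : 𝕜} (hq : q ≠ 0) :
    PoissonIso (qSkewField q) (qSkewField (-q)) := by
  have hb : (flagBracket (algebraMap 𝕜 (RatFun2 𝕜) (-q) * x 𝕜 * y 𝕜)).br (y 𝕜) (x 𝕜) =
      algebraMap 𝕜 _ q * y 𝕜 * x 𝕜 := by
    simp only [flagBracket, LinearMap.mk₂_apply, pd_x, pd_y]
    simp
    ring
  refine poissonIso_of_generates (fun E hy hx => generates_x_y 𝕜 E hx hy) ?_ ?_
  · rw [hb]
    exact mul_ne_zero (mul_ne_zero (by simpa using hq) (y_ne_zero 𝕜)) (x_ne_zero 𝕜)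
  · intro φ hx hy
    rw [hb, map_mul, map_mul, hx, hy, AlgHom.commutes]

lemma poissonIso_qSkewField_iff (q q' : 𝕜) :
    PoissonIso (qSkewField q) (qSkewField q') ↔ q' = q ∨ q' = -q := by
  constructor
  · intro h
    by_cases hq : q = 0
    · by_cases hq' : q' = 0
      · left; rw [hq, hq']
      · rw [hq] at h
        exact absurd h.symm (not_poissonIso_qSkewField_zero (by
          simpa using scaledPowField_x_y_ne_zero hq' 0))
    · by_cases hq' : q' = 0
      · rw [hq'] at h
        exact absurd h (not_poissonIso_qSkewField_zero (by
          simpa using scaledPowField_x_y_ne_zero hq 0))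
      · obtain ⟨z, hz⟩ := exists_int_of_poissonIso_qSkewField hq h
        obtain ⟨z', hz'⟩ := exists_int_of_poissonIso_qSkewField hq' h.symm
        -- Each parameter is an integer multiple of the other, so the integers are units.
        have h1 : (z' * z : ℤ) = 1 := by
          have h2 : q * ((z' * z : ℤ) : 𝕜) = q * 1 := by
            push_cast
            rw [← mul_assoc, ← hz', ← hz, mul_one]
          exact_mod_cast mul_left_cancel₀ hq h2
        rcases Int.eq_one_or_neg_one_of_mul_eq_one h1 with h2 | h2
        · left; rw [hz', h2]; simp
        · right; rw [hz', h2]; simp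
  · rintro (rfl | rfl)
    · exact PoissonIso.refl _
    · by_cases hq : q = 0
      · rw [hq, neg_zero]
        exact PoissonIso.refl _
      · exact poissonIso_qSkewField_neg hq

/-- A monomial bracket `q xᵃ yᵇ` other than `q x y` is isomorphic to some `K_{1,d,0}`. -/
lemma exists_poissonIso_powField [IsAlgClosed 𝕜] {q : 𝕜} (hq : q ≠ 0) {a b : ℤ}
    (hab : ¬ (a = 1 ∧ b = 1)) :
    ∃ d : ℕ, 1 ≤ d ∧ PoissonIso (powField 𝕜 d) (monomialField q a b) := by
  have hx := x_ne_zero 𝕜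
  have hy := y_ne_zero 𝕜
  have hd : 0 < Int.gcd (a - 1) (b - 1) := by
    rw [Int.gcd_pos_iff]
    omega
  obtain ⟨i, j, hcop, hi, hj⟩ := Int.exists_gcd_one hd
  obtain ⟨α, β, hαβ⟩ := Int.isCoprime_iff_gcd_eq_one.2 hcop
  set d := Int.gcd (a - 1) (b - 1)
  have hdet : i * α - j * (-β) = 1 := by linarith
  have hgen := ((generates_x_y 𝕜).zpow_mul_zpow hx hy hdet).1
  -- The quotient `{x, y}/(x y)` is `q` times the `d`-th power of a primitive monomial, which
  -- becomes the first generator.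
  have hxy : (monomialField q a b).br (x 𝕜) (y 𝕜) = x 𝕜 * y 𝕜 *
      (algebraMap 𝕜 _ q * (x 𝕜 ^ i * y 𝕜 ^ j) ^ d) := by
    rw [monomialField, flagBracket_x_y, mul_pow, ← zpow_natCast, ← zpow_natCast, ← zpow_mul,
      ← zpow_mul, ← hi, ← hj, zpow_sub_one₀ hx, zpow_sub_one₀ hy]
    field_simp
  have hb := flagBracket_monomial hx hy hxy i j (-β) α
  rw [hdet, Int.cast_one, one_mul] at hb
  have hU0 : x 𝕜 ^ i * y 𝕜 ^ j ≠ 0 := mul_ne_zero (zpow_ne_zero _ hx) (zpow_ne_zero _ hy)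
  have hW0 : x 𝕜 ^ (-β) * y 𝕜 ^ α ≠ 0 := mul_ne_zero (zpow_ne_zero _ hx) (zpow_ne_zero _ hy)
  set U := x 𝕜 ^ i * y 𝕜 ^ j
  set W := x 𝕜 ^ (-β) * y 𝕜 ^ α
  -- Scaling the first generator by a `d`-th root of `q` absorbs the scalar.
  obtain ⟨l, hl⟩ := IsAlgClosed.exists_pow_nat_eq q hd
  have hl0 : algebraMap 𝕜 (RatFun2 𝕜) l ≠ 0 := by
    rw [Ne, FaithfulSMul.algebraMap_eq_zero_iff]
    rintro rfl
    exact hq (by rw [← hl, zero_pow hd.ne'])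
  have hb' : (flagBracket (algebraMap 𝕜 (RatFun2 𝕜) q * x 𝕜 ^ a * y 𝕜 ^ b)).br
      (algebraMap 𝕜 _ l * U) W = (algebraMap 𝕜 _ l * U) ^ (d + 1) * W := by
    rw [← Algebra.smul_def l U, map_smul, LinearMap.smul_apply, hb, Algebra.smul_def, ← hl,
      map_pow, Algebra.smul_def]
    ring
  refine ⟨d, hd, poissonIso_of_generates (u := algebraMap 𝕜 _ l * U) (w := W) ?_ ?_ ?_⟩
  · intro E hu hw
    refine hgen E ?_ hw
    have h1 := E.mul_mem (E.inv_mem (E.algebraMap_mem l)) hu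
    rwa [inv_mul_cancel_left₀ hl0] at h1
  · rw [hb']
    exact mul_ne_zero (pow_ne_zero _ (mul_ne_zero hl0 hU0)) hW0
  · intro φ hx hy
    rw [hb', map_mul, map_pow, hx, hy]

/-- In `K_{1,1,0}` the generators `y` and `x⁻¹y⁻¹` have bracket `1`. -/
lemma poissonIso_weylField_powField_one : PoissonIso (weylField 𝕜) (powField 𝕜 1) := by
  have hx := x_ne_zero 𝕜
  have hy := y_ne_zero 𝕜
  have hxy : (powField 𝕜 1).br (x 𝕜) (y 𝕜) = x 𝕜 * y 𝕜 * x 𝕜 := by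
    rw [powField, flagBracket_x_y]
    ring
  have hdet : (-1 : ℤ) * (-1) - (-1) * 0 = 1 := by norm_num
  have hb := flagBracket_monomial hx hy hxy 0 1 (-1) (-1)
  have hgen := (generates_x_y 𝕜).zpow_mul_zpow hx hy (a := 0) (b := 1) (c := -1) (d := -1)
    (by norm_num)
  have hb' : (flagBracket (x 𝕜 ^ (1 + 1) * y 𝕜)).br (x 𝕜 ^ (0 : ℤ) * y 𝕜 ^ (1 : ℤ))
      (x 𝕜 ^ (-1 : ℤ) * y 𝕜 ^ (-1 : ℤ)) = 1 := by
    rw [hb]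
    simp only [zpow_zero, zpow_one, zpow_neg_one]
    push_cast
    field_simp
  refine poissonIso_of_generates hgen.1 (by rw [hb']; exact one_ne_zero) ?_
  intro φ _ _
  rw [hb', map_one]

end PoissonIsoLemmas
-- The classification theorem.
theorem proposition4p6 (𝕜 : Type*) [Field 𝕜] [CharZero 𝕜] :
    -- `K_q ≅ K_{q'}` exactly when `q' = ± q`
    (∀ q q' : 𝕜, PoissonIso (qSkewField q) (qSkewField q') ↔ q' = q ∨ q' = -q) ∧
    -- the Weyl Poisson field is `K_{1,1,0}`
    PoissonIso (weylField 𝕜) (powField 𝕜 1) ∧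
    -- the three kinds are pairwise non-isomorphic
    (∀ q : 𝕜, ¬ PoissonIso (qSkewField q) (weylField 𝕜)) ∧
    (∀ (q : 𝕜) (n : ℕ), 2 ≤ n → ¬ PoissonIso (qSkewField q) (powField 𝕜 n)) ∧
    (∀ n : ℕ, 2 ≤ n → ¬ PoissonIso (weylField 𝕜) (powField 𝕜 n)) ∧
    (∀ m n : ℕ, 2 ≤ m → 2 ≤ n → m ≠ n → ¬ PoissonIso (powField 𝕜 m) (powField 𝕜 n)) ∧
    -- over an algebraically closed field they exhaust the fields `K{q xᵃ yᵇ}`, `q ≠ 0`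
    (IsAlgClosed 𝕜 → ∀ q : 𝕜, q ≠ 0 → ∀ a b : ℤ,
      (∃ q' : 𝕜, q' ≠ 0 ∧ PoissonIso (monomialField q a b) (qSkewField q')) ∨
      PoissonIso (monomialField q a b) (weylField 𝕜) ∨
      ∃ n : ℕ, 2 ≤ n ∧ PoissonIso (monomialField q a b) (powField 𝕜 n)) := by
  refine ⟨poissonIso_qSkewField_iff, poissonIso_weylField_powField_one, ?_, ?_, ?_, ?_, ?_⟩
  · intro q h
    by_cases hq : q = 0
    · rw [hq] at h
      exact not_poissonIso_qSkewField_zero one_ne_zero h.symm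
    · rw [qSkewField_eq] at h
      exact not_poissonIso_weylField hq zero_ne_one h.symm
  · intro q n hn h
    by_cases hq : q = 0
    · rw [hq] at h
      exact not_poissonIso_qSkewField_zero (mul_ne_zero (pow_ne_zero _ (x_ne_zero 𝕜))
        (y_ne_zero 𝕜)) h.symm
    · rw [qSkewField_eq] at h
      have := eq_of_poissonIso_powField hq (by omega) h.symm
      omega
  · intro n hn h
    rw [powField_eq] at h
    exact not_poissonIso_weylField one_ne_zero (by omega) h
  · intro m n hm hn hmn h
    rw [powField_eq n] at h
    have := eq_of_poissonIso_powField one_ne_zero (by omega) h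
    omega
  · intro _ q hq a b
    by_cases hab : a = 1 ∧ b = 1
    · left
      refine ⟨q, hq, ?_⟩
      rw [hab.1, hab.2, ← qSkewField_eq_monomialField]
      exact PoissonIso.refl _
    · right
      obtain ⟨d, hd, h⟩ := exists_poissonIso_powField hq hab
      -- The value `d = 1` is the Weyl field.
      rcases hd.eq_or_lt with h1 | h1
      · left
        rw [← h1] at h
        exact (poissonIso_weylField_powField_one.trans h).symm
      · exact Or.inr ⟨d, h1, h.symm⟩
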